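/- Let $S\subset\mathbb P^3(\mathbb C)$ be a quartic surface, i.e. the zero locus of a non-zero homogeneous polynomial $f\in\mathbb C[x_1,\dots,x_4]$ of degree $4$. Suppose that $S$ is not ruled by lines, i.e. that it contains only finitely many lines, and that $S$ contains a line $\ell_0$ of double points, i.e. a line at every point of which $f$ and all its first partial derivatives vanish (points of multiplicity greater than two on $\ell_0$ are allowed). Then $S$ contains at most $35$ lines. -/

import Mathlib

open MvPolynomial

/-- A line of `ℙ³(ℂ)`, i.e. a two-dimensional linear subspace of `ℂ⁴`: its points are the
one-dimensional subspaces `ℂ v` with `0 ≠ v ∈ L`. -/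
def IsLine (L : Submodule ℂ (Fin 4 → ℂ)) : Prop :=
  Module.finrank ℂ L = 2

/-- The set of lines of `ℙ³(ℂ)` that lie on the surface `f = 0`. -/
def linesOn (f : MvPolynomial (Fin 4) ℂ) : Set (Submodule ℂ (Fin 4 → ℂ)) :=
  {L | IsLine L ∧ ∀ v ∈ L, eval v f = 0}

/-- The surface `f = 0` is ruled by lines if it contains infinitely many lines. -/
def RuledByLines (f : MvPolynomial (Fin 4) ℂ) : Prop :=
  (linesOn f).Infinite

/-- The point `ℂ v` of `ℙ³(ℂ)` is a singular point of the surface `f = 0`, that is, a point of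
multiplicity at least two: `f` and all its first partial derivatives vanish there. -/
def IsSingularPoint (f : MvPolynomial (Fin 4) ℂ) (v : Fin 4 → ℂ) : Prop :=
  eval v f = 0 ∧ ∀ i, eval v (pderiv i f) = 0

/-- The surface `f = 0` contains a line along which it is (at least) double. A line of points
of higher multiplicity, or isolated points of higher multiplicity on the line, are allowed. -/
def ContainsDoubleLine (f : MvPolynomial (Fin 4) ℂ) : Prop :=
  ∃ L ∈ linesOn f, ∀ v ∈ L, v ≠ 0 → IsSingularPoint f v

/-! Put the double line at x₀ = x₁ = 0. Then f is quadratic in (x₂, x₃), with binary forms in (x₀,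
x₁) of degrees 4, 3, 3, 2, 2, 2 as coefficients: a ternary quadratic form Q over the pencil of
planes through the double line, each plane cutting out that line twice and a residual conic. The
discriminant D of Q has degree 8. If D vanished identically, almost every residual conic would
contain a line, or f would depend on x₀, x₁ only and S would contain a plane; either way S would be
ruled.

A line of S meeting the double line lies in a plane of the pencil with degenerate conic. There are
at most 8 such planes, with at most two lines in each, since a conic containing three lines is a
whole plane.

A line skew to the double line is a vector vᵢ = (1, z, w) with z, w linear, isotropic for Q over
ℂ[X]. The polar products Bᵢⱼ = B(vᵢ, vⱼ) have degree at most 4, are non-zero for i ≠ j, and satisfy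
the Gram identity Bᵢⱼ Bᵢₖ Bⱼₖ = D T², where T is the determinant of the three vectors. At a root p
of D, let μ be the least order of the Bᵢⱼ. The Gram identities put the vᵢ at positions on a chain of
some length e ≥ ord D − 2μ, and Bᵢⱼ vanishes to order at least μ + e − (distance of the positions)
(`exists_chain`). Encode each position in unary and concatenate over all p. With m = 4 − Σμ this
gives binary words of length at least 2m that pairwise agree in at most m places, so the Plotkin
bound leaves at most 4m ≤ 16 lines if m ≥ 1. If Σμ reaches 4, all Bᵢⱼ are constant multiples of one
polynomial, and any three of the lines generate a conic of lines on S, so S is ruled.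

The total is 1 + 16 + 16 = 33, slightly better than required. -/

/-! ### Binary codes -/

/-- Plotkin bound: at most `4 * m` binary words of length at least `2 * m` can pairwise agree in at
most `m` places. -/
theorem card_le_of_agree_le {ι κ : Type*} [Fintype ι] [Fintype κ] (u : ι → κ → Bool) (m : ℕ)
    (hm : 1 ≤ m) (hκ : 2 * m ≤ Fintype.card κ)
    (hu : ∀ i j, i ≠ j → (Finset.univ.filter fun k => u i k = u j k).card ≤ m) :
    Fintype.card ι ≤ 4 * m := by
  classical
  obtain ⟨K, -, hK⟩ := Finset.exists_subset_card_eq (s := (Finset.univ : Finset κ))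
    (n := 2 * m) (by simpa using hκ)
  obtain ⟨k₀, hk₀⟩ : K.Nonempty := by rw [← Finset.card_pos]; omega
  let ε : ι → κ → ℤ := fun i k => if u i k then 1 else -1
  have hεε : ∀ i j k, ε i k * ε j k = 2 * (if u i k = u j k then 1 else 0) - 1 := by
    intro i j k
    simp only [ε]
    cases u i k <;> cases u j k <;> simp
  have hsum : ∀ i j, ∑ k ∈ K, ε i k * ε j k
      = 2 * ((K.filter fun k => u i k = u j k).card : ℤ) - 2 * m := by
    intro i j
    simp only [hεε, Finset.sum_sub_distrib, ← Finset.mul_sum, Finset.sum_boole, Finset.sum_const,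
      hK]
    simp
  have half : ∀ b : Bool, (Finset.univ.filter fun i => u i k₀ = b).card ≤ 2 * m := by
    intro b
    set J := Finset.univ.filter fun i => u i k₀ = b with hJ
    have h0 : 0 ≤ ∑ k ∈ K.erase k₀, (∑ i ∈ J, ε i k) ^ 2 :=
      Finset.sum_nonneg fun k _ => sq_nonneg _
    have h1 : ∑ k ∈ K.erase k₀, (∑ i ∈ J, ε i k) ^ 2
        = ∑ i ∈ J, ∑ j ∈ J, ∑ k ∈ K.erase k₀, ε i k * ε j k := by
      simp only [sq, Finset.sum_mul_sum]
      rw [Finset.sum_comm]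
      refine Finset.sum_congr rfl fun i _ => ?_
      rw [Finset.sum_comm]
    -- Over all of `K` the ±1 words have inner product 2·(agreements) − 2m ≤ 0. Words in `J` agree
    -- at `k₀`, so deleting that place lowers it to at most −1. Such vectors number at most 2m
    -- because the square of their sum is non-negative.
    have h2 : ∀ i ∈ J, ∀ j ∈ J, ∑ k ∈ K.erase k₀, ε i k * ε j k
        ≤ if i = j then (2 * m - 1 : ℤ) else -1 := by
      intro i hi j hj
      have hi' : u i k₀ = b := by simpa [hJ] using hi
      have hj' : u j k₀ = b := by simpa [hJ] using hj
      have e1 := Finset.add_sum_erase K (fun k => ε i k * ε j k) hk₀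
      have e2 : ε i k₀ * ε j k₀ = 1 := by rw [hεε, hi', hj']; simp
      rw [hsum] at e1
      simp only [e2] at e1
      have e3 : (K.filter fun k => u i k = u j k).card ≤ 2 * m :=
        hK ▸ Finset.card_filter_le _ _
      split_ifs with hij
      · omega
      · have e4 : (K.filter fun k => u i k = u j k).card ≤ m :=
          (Finset.card_le_card (Finset.filter_subset_filter _ (Finset.subset_univ K))).trans
            (hu i j hij)
        omega
    have h3 : ∑ i ∈ J, ∑ j ∈ J, ∑ k ∈ K.erase k₀, ε i k * ε j k
        ≤ ∑ i ∈ J, ∑ j ∈ J, if i = j then (2 * m - 1 : ℤ) else -1 :=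
      Finset.sum_le_sum fun i hi => Finset.sum_le_sum fun j hj => h2 i hi j hj
    have h4 : ∑ i ∈ J, ∑ j ∈ J, (if i = j then (2 * m - 1 : ℤ) else -1)
        = J.card * (2 * m - J.card) := by
      have : ∀ i j : ι, (if i = j then (2 * m - 1 : ℤ) else -1) = (if i = j then 2 * m else 0) - 1 := by
        intro i j; split_ifs <;> simp
      simp only [this, Finset.sum_sub_distrib]
      rw [Finset.sum_congr rfl (g := fun _ => (2 * m : ℤ)) (fun i hi => by simp [hi])]
      simp
      ring
    by_contra hlt
    push Not at hlt
    have : (J.card : ℤ) * (2 * m - J.card) < 0 := by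
      apply mul_neg_of_pos_of_neg
      · omega
      · omega
    omega
  have := half true
  have := half false
  have hc : Fintype.card ι = (Finset.univ.filter fun i => u i k₀ = true).card
      + (Finset.univ.filter fun i => u i k₀ = false).card := by
    rw [← Finset.card_univ, ← Finset.card_filter_add_card_filter_not (fun i => u i k₀ = true)]
    simp
  omega

/-! ### Ternary quadratic forms and Gram identities -/

/-- The ternary quadratic form `a r² + b₁ r z + b₂ r w + c₁₁ z² + c₁₂ z w + c₂₂ w²`. -/
structure TernaryForm (R : Type*) where
  (a b₁ b₂ c₁₁ c₁₂ c₂₂ : R)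

namespace TernaryForm

variable {R : Type*} [CommRing R]

/-- The value of a ternary form. -/
def val (q : TernaryForm R) (r z w : R) : R :=
  q.a * r ^ 2 + q.b₁ * r * z + q.b₂ * r * w + q.c₁₁ * z ^ 2 + q.c₁₂ * z * w + q.c₂₂ * w ^ 2

/-- The polar form of a ternary form. -/
def polar (q : TernaryForm R) (r z w r' z' w' : R) : R :=
  2 * q.a * r * r' + q.b₁ * (r * z' + r' * z) + q.b₂ * (r * w' + r' * w) + 2 * q.c₁₁ * z * z'
    + q.c₁₂ * (z * w' + z' * w) + 2 * q.c₂₂ * w * w'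

/-- The discriminant of a ternary form: half the determinant of its polar form. -/
def disc (q : TernaryForm R) : R :=
  4 * q.a * q.c₁₁ * q.c₂₂ + q.b₁ * q.b₂ * q.c₁₂ - q.a * q.c₁₂ ^ 2 - q.c₁₁ * q.b₂ ^ 2
    - q.c₂₂ * q.b₁ ^ 2

/-- The determinant of the vectors `(1, z₁, w₁)`, `(1, z₂, w₂)`, `(1, z₃, w₃)`. -/
def area (v₁ v₂ v₃ : R × R) : R :=
  (v₂.1 - v₁.1) * (v₃.2 - v₁.2) - (v₃.1 - v₁.1) * (v₂.2 - v₁.2)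

/-- The polar form on vectors with first coordinate `1`. -/
def pol (q : TernaryForm R) (v v' : R × R) : R := q.polar 1 v.1 v.2 1 v'.1 v'.2

theorem pol_self {q : TernaryForm R} {v : R × R} (h : q.val 1 v.1 v.2 = 0) : q.pol v v = 0 := by
  simp only [pol, polar, val] at *; linear_combination 2 * h

/-- Determinant of the matrix of products of (v₁, v₂, v) with (v₁, v₂, v′): it factors as `area` ·
det(polar matrix) · `area`, and the polar matrix has determinant `2 * q.disc`. -/
theorem gram_mixed (q : TernaryForm R) (v₁ v₂ v v' : R × R) (h₁ : q.pol v₁ v₁ = 0)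
    (h₂ : q.pol v₂ v₂ = 0) :
    q.pol v₁ v₂ ^ 2 * q.pol v v' = q.pol v₁ v₂ * (q.pol v₂ v' * q.pol v₁ v
      + q.pol v₂ v * q.pol v₁ v') - 2 * q.disc * area v₁ v₂ v * area v₁ v₂ v' := by
  have key : q.pol v₁ v₁ * (q.pol v₂ v₂ * q.pol v v' - q.pol v₂ v' * q.pol v₂ v)
      - q.pol v₁ v₂ * (q.pol v₁ v₂ * q.pol v v' - q.pol v₂ v' * q.pol v₁ v)
      + q.pol v₁ v' * (q.pol v₁ v₂ * q.pol v₂ v - q.pol v₂ v₂ * q.pol v₁ v)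
      = 2 * q.disc * area v₁ v₂ v * area v₁ v₂ v' := by
    simp only [pol, polar, disc, area]; ring
  rw [h₁, h₂] at key
  linear_combination -key

theorem gram (q : TernaryForm R) [IsDomain R] [CharZero R] (v₁ v₂ v₃ : R × R)
    (h₁ : q.pol v₁ v₁ = 0) (h₂ : q.pol v₂ v₂ = 0) (h₃ : q.pol v₃ v₃ = 0) :
    q.pol v₁ v₂ * q.pol v₁ v₃ * q.pol v₂ v₃ = q.disc * area v₁ v₂ v₃ ^ 2 := by
  have := gram_mixed q v₁ v₂ v₃ v₃ h₁ h₂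
  rw [h₃] at this
  apply mul_left_cancel₀ (two_ne_zero (α := R))
  linear_combination -this

/-- `T² M = adj(W)ᵀ G adj(W)` for the Gram matrix `G = Wᵀ M W`: a common divisor of the entries of
`G` divides `T²` times each coefficient of the form (up to a factor 2). -/
theorem dvd_area_sq_mul {q : TernaryForm R} {d : R} {v₁ v₂ v₃ : R × R}
    (h₁ : q.pol v₁ v₁ = 0) (h₂ : q.pol v₂ v₂ = 0) (h₃ : q.pol v₃ v₃ = 0)
    (h₁₂ : d ∣ q.pol v₁ v₂) (h₁₃ : d ∣ q.pol v₁ v₃) (h₂₃ : d ∣ q.pol v₂ v₃) (x y z x' y' z' : R) :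
    d ∣ area v₁ v₂ v₃ ^ 2 * q.polar x y z x' y' z' := by
  obtain ⟨g₁₂, h₁₂⟩ := h₁₂
  obtain ⟨g₁₃, h₁₃⟩ := h₁₃
  obtain ⟨g₂₃, h₂₃⟩ := h₂₃
  let k₁ : R → R → R → R := fun x y z =>
    x * (v₂.1 * v₃.2 - v₃.1 * v₂.2) + y * (v₂.2 - v₃.2) + z * (v₃.1 - v₂.1)
  let k₂ : R → R → R → R := fun x y z =>
    x * (v₃.1 * v₁.2 - v₁.1 * v₃.2) + y * (v₃.2 - v₁.2) + z * (v₁.1 - v₃.1)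
  let k₃ : R → R → R → R := fun x y z =>
    x * (v₁.1 * v₂.2 - v₂.1 * v₁.2) + y * (v₁.2 - v₂.2) + z * (v₂.1 - v₁.1)
  have hx : ∀ x y z, area v₁ v₂ v₃ * x = k₁ x y z + k₂ x y z + k₃ x y z := by
    intro x y z; simp only [area, k₁, k₂, k₃]; ring
  have hy : ∀ x y z, area v₁ v₂ v₃ * y = k₁ x y z * v₁.1 + k₂ x y z * v₂.1 + k₃ x y z * v₃.1 := by
    intro x y z; simp only [area, k₁, k₂, k₃]; ring
  have hz : ∀ x y z, area v₁ v₂ v₃ * z = k₁ x y z * v₁.2 + k₂ x y z * v₂.2 + k₃ x y z * v₃.2 := by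
    intro x y z; simp only [area, k₁, k₂, k₃]; ring
  have e1 : area v₁ v₂ v₃ ^ 2 * q.polar x y z x' y' z' =
      q.polar (area v₁ v₂ v₃ * x) (area v₁ v₂ v₃ * y) (area v₁ v₂ v₃ * z)
        (area v₁ v₂ v₃ * x') (area v₁ v₂ v₃ * y') (area v₁ v₂ v₃ * z') := by
    simp only [polar]; ring
  rw [e1, hx x y z, hy x y z, hz x y z, hx x' y' z', hy x' y' z', hz x' y' z']
  generalize k₁ x y z = p₁, k₂ x y z = p₂, k₃ x y z = p₃
  generalize k₁ x' y' z' = p₁', k₂ x' y' z' = p₂', k₃ x' y' z' = p₃'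
  refine ⟨(p₁ * p₂' + p₂ * p₁') * g₁₂ + (p₁ * p₃' + p₃ * p₁') * g₁₃
    + (p₂ * p₃' + p₃ * p₂') * g₂₃, ?_⟩
  simp only [pol, polar] at *
  linear_combination (p₁ * p₁') * h₁ + (p₂ * p₂') * h₂ + (p₃ * p₃') * h₃
    + (p₁ * p₂' + p₂ * p₁') * h₁₂ + (p₁ * p₃' + p₃ * p₁') * h₁₃ + (p₂ * p₃' + p₃ * p₂') * h₂₃

/-- A ternary form with a totally isotropic plane `⟨(1, h₂, h₃), (0, k₂, k₃)⟩` is degenerate. -/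
theorem disc_eq_zero_of_isotropic [IsDomain R] [CharZero R] {q : TernaryForm R} {h₂ h₃ k₂ k₃ : R}
    (e₁ : q.val 1 h₂ h₃ = 0) (e₂ : q.polar 1 h₂ h₃ 0 k₂ k₃ = 0) (e₃ : q.val 0 k₂ k₃ = 0)
    (hk : k₂ ≠ 0 ∨ k₃ ≠ 0) : q.disc = 0 := by
  -- Gram determinant of the two given vectors and (0, y, z); the last factor is the square of their
  -- determinant. The choice of (y, z) below completes them to a basis.
  have key : ∀ y z : R, 2 * q.val 1 h₂ h₃ * (2 * q.val 0 k₂ k₃ * (2 * q.val 0 y z)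
        - q.polar 0 k₂ k₃ 0 y z ^ 2)
      - q.polar 1 h₂ h₃ 0 k₂ k₃ * (q.polar 1 h₂ h₃ 0 k₂ k₃ * (2 * q.val 0 y z)
        - q.polar 0 k₂ k₃ 0 y z * q.polar 1 h₂ h₃ 0 y z)
      + q.polar 1 h₂ h₃ 0 y z * (q.polar 1 h₂ h₃ 0 k₂ k₃ * q.polar 0 k₂ k₃ 0 y z
        - 2 * q.val 0 k₂ k₃ * q.polar 1 h₂ h₃ 0 y z) = 2 * q.disc * (k₂ * z - k₃ * y) ^ 2 := by
    intro y z; simp only [val, polar, disc]; ring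
  rw [e₁, e₂, e₃] at key
  rcases hk with hk | hk
  · simpa [hk] using (key 0 1).symm
  · simpa [hk] using (key 1 0).symm

/-- Two orthogonal isotropic vectors v ≠ v′ would make the plane ⟨v, v′ − v⟩ totally isotropic. -/
theorem pol_ne_zero [IsDomain R] [CharZero R] {q : TernaryForm R} (hq : q.disc ≠ 0) {v v' : R × R}
    (hv : q.val 1 v.1 v.2 = 0) (hv' : q.val 1 v'.1 v'.2 = 0) (hne : v ≠ v') :
    q.pol v v' ≠ 0 := by
  intro h
  apply hq
  refine disc_eq_zero_of_isotropic (k₂ := v'.1 - v.1) (k₃ := v'.2 - v.2) hv ?_ ?_ ?_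
  · simp only [pol, polar, val] at *; linear_combination h - 2 * hv
  · simp only [pol, polar, val] at *; linear_combination hv' + hv - h
  · by_contra hc
    push Not at hc
    exact hne (Prod.ext (sub_eq_zero.1 hc.1).symm (sub_eq_zero.1 hc.2).symm)

end TernaryForm

/-! ### Local structure at a point of the pencil -/

theorem Prime.exists_pow_dvd_of_pow_dvd_mul {R : Type*} [CommRing R] [IsDomain R] {π : R}
    (hπ : Prime π) (n : ℕ) : ∀ {x y : R}, π ^ n ∣ x * y → ∃ i ≤ n, π ^ i ∣ x ∧ π ^ (n - i) ∣ y := by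
  induction n with
  | zero => intro x y _; exact ⟨0, le_rfl, by simp, by simp⟩
  | succ n ih =>
    intro x y h
    have h1 : π ∣ x * y := (dvd_pow_self π n.succ_ne_zero).trans h
    rcases hπ.dvd_or_dvd h1 with ⟨x', rfl⟩ | ⟨y', rfl⟩
    · have : π ^ n ∣ x' * y := by
        rw [pow_succ', mul_assoc] at h
        exact (mul_dvd_mul_iff_left hπ.ne_zero).1 h
      obtain ⟨i, hi, h1, h2⟩ := ih this
      exact ⟨i + 1, by omega, by rw [pow_succ']; exact mul_dvd_mul_left _ h1,
        by rwa [Nat.add_sub_add_right]⟩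
    · have : π ^ n ∣ x * y' := by
        rw [pow_succ', mul_left_comm] at h
        exact (mul_dvd_mul_iff_left hπ.ne_zero).1 h
      obtain ⟨i, hi, h1, h2⟩ := ih this
      refine ⟨i, by omega, h1, ?_⟩
      rw [show n + 1 - i = n - i + 1 by omega, pow_succ']
      exact mul_dvd_mul_left _ h2

namespace TernaryForm

open Polynomial in
/-- Local structure of a set of isotropic vectors at a point `p`: after removing the common part
`μ` of the polar products, they behave like the ends of a chain of length `e`. -/
theorem exists_chain {ι : Type*} [Fintype ι] [DecidableEq ι] (hι : 3 ≤ Fintype.card ι)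
    (q : TernaryForm ℂ[X])
    (v : ι → ℂ[X] × ℂ[X]) (hv : ∀ i, q.pol (v i) (v i) = 0)
    (hB : ∀ i j, i ≠ j → q.pol (v i) (v j) ≠ 0) (hD : q.disc ≠ 0) (p : ℂ)
    (hp : ∃ x y z x' y' z' : ℂ[X], ¬ (Polynomial.X - Polynomial.C p) ∣ q.polar x y z x' y' z') :
    ∃ (μ e : ℕ) (idx : ι → ℕ), (∀ i, idx i ≤ e) ∧
      (∀ i j, i ≠ j → μ ≤ (q.pol (v i) (v j)).rootMultiplicity p) ∧
      q.disc.rootMultiplicity p ≤ e + 2 * μ ∧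
      ∀ i j, i ≠ j → e + μ ≤ (q.pol (v i) (v j)).rootMultiplicity p
        + (max (idx i) (idx j) - min (idx i) (idx j)) := by
  set π : ℂ[X] := Polynomial.X - Polynomial.C p with hπdef
  have hπ : Prime π := prime_X_sub_C p
  let m : ℂ[X] → ℕ := fun P => P.rootMultiplicity p
  have hm : ∀ {P : ℂ[X]} {n : ℕ}, P ≠ 0 → (n ≤ m P ↔ π ^ n ∣ P) := fun hP => le_rootMultiplicity_iff hP
  have hmul : ∀ {P Q : ℂ[X]}, P * Q ≠ 0 → m (P * Q) = m P + m Q := fun h => rootMultiplicity_mul h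
  let B : ι → ι → ℂ[X] := fun i j => q.pol (v i) (v j)
  let T : ι → ι → ι → ℂ[X] := fun i j k => area (v i) (v j) (v k)
  have gram1 : ∀ i j k, B i j * B i k * B j k = q.disc * T i j k ^ 2 := fun i j k =>
    q.gram _ _ _ (hv i) (hv j) (hv k)
  have gram2 : ∀ i j k l, B i j ^ 2 * B k l = B i j * (B j l * B i k + B j k * B i l)
      - 2 * q.disc * T i j k * T i j l := fun i j k l =>
    q.gram_mixed _ _ _ _ (hv i) (hv j)
  -- a pair minimizing the multiplicity
  have hne : (Finset.univ.filter fun ij : ι × ι => ij.1 ≠ ij.2).Nonempty := by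
    obtain ⟨i, j, hij⟩ := Fintype.exists_pair_of_one_lt_card (α := ι) (by omega)
    exact ⟨(i, j), by simpa using hij⟩
  obtain ⟨⟨i₁, i₂⟩, h12, hmin⟩ := Finset.exists_min_image _ (fun ij : ι × ι => m (B ij.1 ij.2)) hne
  simp only [Finset.mem_filter, Finset.mem_univ, true_and] at h12 hmin
  set μ := m (B i₁ i₂) with hμ
  have hμle : ∀ i j, i ≠ j → μ ≤ m (B i j) := fun i j hij => hmin (i, j) hij
  have hμdvd : ∀ i j, π ^ μ ∣ B i j := by
    intro i j
    by_cases hij : i = j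
    · subst hij; simp only [B, hv]; exact dvd_zero _
    · exact (hm (hB i j hij)).1 (hμle i j hij)
  have hTne : ∀ i j k, i ≠ j → i ≠ k → j ≠ k → T i j k ≠ 0 := by
    intro i j k hij hik hjk h
    have := gram1 i j k
    rw [h] at this
    simp [B, hB i j hij, hB i k hik, hB j k hjk] at this
  -- a third vector minimizing the multiplicity of the area
  have hne' : (Finset.univ.filter fun k : ι => k ≠ i₁ ∧ k ≠ i₂).Nonempty := by
    rw [← Finset.card_pos]
    have h1 : (Finset.univ.filter fun k : ι => k ≠ i₁ ∧ k ≠ i₂) = Finset.univ \ {i₁, i₂} := by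
      ext; simp
    rw [h1, Finset.card_sdiff_of_subset (Finset.subset_univ _), Finset.card_univ]
    have := Finset.card_le_two (a := i₁) (b := i₂)
    omega
  obtain ⟨k₀, hk₀, hkmin⟩ := Finset.exists_min_image _ (fun k : ι => m (T i₁ i₂ k)) hne'
  simp only [Finset.mem_filter, Finset.mem_univ, true_and] at hk₀ hkmin
  set ν := m (T i₁ i₂ k₀) with hν
  have hT0 : T i₁ i₂ k₀ ≠ 0 := hTne _ _ _ h12 (Ne.symm hk₀.1) (Ne.symm hk₀.2)
  have hνdvd : ∀ k, π ^ ν ∣ T i₁ i₂ k := by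
    intro k
    by_cases hk : k ≠ i₁ ∧ k ≠ i₂
    · exact (hm (hTne _ _ _ h12 (Ne.symm hk.1) (Ne.symm hk.2))).1 (hkmin k hk)
    · have : T i₁ i₂ k = 0 := by
        by_cases h1 : k = i₁
        · subst h1; simp only [T, area]; ring
        · have : k = i₂ := by tauto
          subst this; simp only [T, area]; ring
      rw [this]; exact dvd_zero _
  -- `μ ≤ 2 ν`
  have hμν : μ ≤ 2 * ν := by
    obtain ⟨x, y, z, x', y', z', hnd⟩ := hp
    have h1 := dvd_area_sq_mul (hv i₁) (hv i₂) (hv k₀) (hμdvd i₁ i₂) (hμdvd i₁ k₀) (hμdvd i₂ k₀)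
      x y z x' y' z'
    have h2 : π ^ μ ∣ T i₁ i₂ k₀ ^ 2 := hπ.pow_dvd_of_dvd_mul_right _ hnd h1
    have h3 := (hm (pow_ne_zero 2 hT0)).2 h2
    have h4 : m (T i₁ i₂ k₀ ^ 2) = 2 * ν := by
      rw [sq, hmul (mul_ne_zero hT0 hT0)]; omega
    omega
  set d := m q.disc with hd
  have h3μ : 3 * μ ≤ d + 2 * ν := by
    have h := congrArg m (gram1 i₁ i₂ k₀)
    have hb1 : B i₁ i₂ ≠ 0 := hB _ _ h12
    have hb2 : B i₁ k₀ ≠ 0 := hB _ _ (Ne.symm hk₀.1)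
    have hb3 : B i₂ k₀ ≠ 0 := hB _ _ (Ne.symm hk₀.2)
    rw [hmul (mul_ne_zero (mul_ne_zero hb1 hb2) hb3), hmul (mul_ne_zero hb1 hb2),
      hmul (mul_ne_zero hD (pow_ne_zero 2 hT0)), sq, hmul (mul_ne_zero hT0 hT0)] at h
    have l1 := hμle _ _ (Ne.symm hk₀.1)
    have l2 := hμle _ _ (Ne.symm hk₀.2)
    omega
  -- Dividing the Gram identity for (i₁, i₂, k) by π^(3μ) leaves π^e dividing B′(i₁,i₂) B′(i₁,k)
  -- B′(i₂,k), whose first factor is prime to π. Splitting π^e between the other two gives the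
  -- position of k between the ends i₁ and i₂. Since μ ≤ 2ν, e + 2μ ≥ d.
  obtain ⟨e, he⟩ : ∃ e, e + 3 * μ = d + 2 * ν := ⟨d + 2 * ν - 3 * μ, by omega⟩
  choose B' hB' using hμdvd
  choose T' hT' using hνdvd
  obtain ⟨D', hD'⟩ : π ^ d ∣ q.disc := (hm hD).1 le_rfl
  have hπ3 : π ^ (3 * μ) ≠ 0 := pow_ne_zero _ hπ.ne_zero
  have hh : ¬ π ∣ B' i₁ i₂ := by
    rintro ⟨c, hc⟩
    have : π ^ (μ + 1) ∣ B i₁ i₂ := ⟨c, by rw [hB', hc]; ring⟩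
    have h' : μ + 1 ≤ m (B i₁ i₂) := (hm (hB _ _ h12)).2 this
    omega
  have hidx : ∀ k, ∃ i ≤ e, π ^ i ∣ B' i₁ k ∧ π ^ (e - i) ∣ B' i₂ k := by
    intro k
    apply hπ.exists_pow_dvd_of_pow_dvd_mul
    refine hπ.pow_dvd_of_dvd_mul_left (a := B' i₁ i₂) _ hh ⟨D' * T' k ^ 2, ?_⟩
    apply mul_left_cancel₀ hπ3
    have := gram1 i₁ i₂ k
    rw [hB', hB' i₁ k, hB' i₂ k, hD', hT'] at this
    have e1 : π ^ (3 * μ) * (π ^ e * (D' * T' k ^ 2)) = π ^ d * D' * (π ^ ν * T' k) ^ 2 := by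
      rw [show π ^ d * D' * (π ^ ν * T' k) ^ 2 = π ^ (d + 2 * ν) * (D' * T' k ^ 2) by ring, ← he]
      ring
    rw [e1, ← this]; ring
  choose idx hidx1 hidx2 hidx3 using hidx
  refine ⟨μ, e, idx, hidx1, hμle, by change d ≤ _; omega, ?_⟩
  intro k l hkl
  change e + μ ≤ m (B k l) + _
  set δ := max (idx k) (idx l) - min (idx k) (idx l) with hδ
  have hk1 := hidx1 k
  have hl1 := hidx1 l
  have hδe : δ ≤ e := by omega
  suffices h : π ^ (e - δ) ∣ B' k l by
    obtain ⟨c, hc⟩ := h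
    have : π ^ (μ + (e - δ)) ∣ B k l := ⟨c, by rw [hB', hc]; ring⟩
    have h' : μ + (e - δ) ≤ m (B k l) := (hm (hB _ _ hkl)).2 this
    omega
  refine (hπ.pow_dvd_of_dvd_mul_left (a := B' i₁ i₂ ^ 2) _
    (fun h => hh (hπ.dvd_of_dvd_pow h)) ?_)
  have hprod : ∀ k l, e - δ ≤ idx k + (e - idx l) → π ^ (e - δ) ∣ B' i₁ k * B' i₂ l := by
    intro k l h
    refine (pow_dvd_pow π h).trans ?_
    rw [pow_add]; exact mul_dvd_mul (hidx2 k) (hidx3 l)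
  have g := gram2 i₁ i₂ k l
  -- The mixed Gram identity modulo π^e: up to a factor prime to π, B′(k,l) is a sum of two cross
  -- terms, of orders at least idx k + e − idx l and idx l + e − idx k.
  have key : B' i₁ i₂ ^ 2 * B' k l = B' i₁ i₂ * (B' i₁ k * B' i₂ l + B' i₁ l * B' i₂ k)
      - π ^ e * (2 * D' * T' k * T' l) := by
    apply mul_left_cancel₀ hπ3
    rw [hB', hB' k l, hB' i₁ k, hB' i₂ k, hB' i₁ l, hB' i₂ l, hD', hT' k, hT' l] at g
    have e1 : π ^ (3 * μ) * (π ^ e * (2 * D' * T' k * T' l))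
        = 2 * (π ^ d * D') * (π ^ ν * T' k) * (π ^ ν * T' l) := by
      rw [show 2 * (π ^ d * D') * (π ^ ν * T' k) * (π ^ ν * T' l)
        = π ^ (d + 2 * ν) * (2 * D' * T' k * T' l) by ring, ← he]
      ring
    rw [mul_sub, e1]
    linear_combination g
  rw [mul_comm] at key
  rw [mul_comm, key]
  refine dvd_sub (Dvd.dvd.mul_left (dvd_add (hprod k l (by omega)) (hprod l k (by omega))) _) ?_
  exact Dvd.dvd.mul_right (pow_dvd_pow π (by omega)) _

end TernaryForm

/-! ### Counting isotropic vectors over ℂ[X] -/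

namespace TernaryForm

open Polynomial in
/-- Finitely many pairwise distinct isotropic vectors over `ℂ[X]`, for a form with discriminant of
degree `8` and polar products of degree at most `4`: there are at most `16`, unless all polar
products are proportional. -/
theorem card_le_or_proportional {ι : Type*} [Fintype ι] (q : TernaryForm ℂ[X])
    (v : ι → ℂ[X] × ℂ[X]) (hv : ∀ i, q.pol (v i) (v i) = 0)
    (hB : ∀ i j, i ≠ j → q.pol (v i) (v j) ≠ 0)
    (hdeg : ∀ i j, (q.pol (v i) (v j)).natDegree ≤ 4) (hD : q.disc.natDegree = 8)
    (hp : ∀ p : ℂ, ∃ x y z x' y' z' : ℂ[X],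
      ¬ (Polynomial.X - Polynomial.C p) ∣ q.polar x y z x' y' z') :
    Fintype.card ι ≤ 16 ∨ ∃ g : ℂ[X], ∀ i j, ∃ c : ℂ, q.pol (v i) (v j) = Polynomial.C c * g := by
  classical
  rcases Nat.lt_or_ge (Fintype.card ι) 3 with h3 | h3
  · exact Or.inl (by omega)
  have hD0 : q.disc ≠ 0 := by rintro h; simp [h] at hD
  choose μ e idx hidx hμ he hchain using
    fun p => exists_chain h3 q v hv hB hD0 p (hp p)
  let P : Finset ℂ := q.disc.roots.toFinset
  have hP : ∑ p ∈ P, q.disc.rootMultiplicity p = 8 := by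
    have h := Multiset.toFinset_sum_count_eq q.disc.roots
    rw [← (IsAlgClosed.splits q.disc).natDegree_eq_card_roots, hD] at h
    simpa [count_roots] using h
  have hBsum : ∀ i j, i ≠ j → ∑ p ∈ P, (q.pol (v i) (v j)).rootMultiplicity p ≤ 4 := by
    intro i j hij
    refine le_trans ?_ (hdeg i j)
    refine le_trans ?_ (card_roots' _)
    simp only [← count_roots]
    rw [← Multiset.sum_count_eq_card (s := P ∪ (q.pol (v i) (v j)).roots.toFinset)
      (fun a ha => Finset.mem_union_right _ (Multiset.mem_toFinset.2 ha))]
    exact Finset.sum_le_sum_of_subset Finset.subset_union_left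
  have hμsum : ∑ p ∈ P, μ p ≤ 4 := by
    obtain ⟨i, j, hij⟩ := Fintype.exists_pair_of_one_lt_card (α := ι) (by omega)
    exact (Finset.sum_le_sum fun p _ => hμ p i j hij).trans (hBsum i j hij)
  rcases Nat.lt_or_ge (∑ p ∈ P, μ p) 4 with h4 | h4
  · left
    -- Unary encoding: at p the words of i and j differ in exactly |idx i − idx j| of the `e p`
    -- places, hence agree in at most ord Bᵢⱼ − μ. Summed over p this is at most m = 4 − Σμ, while
    -- the length is at least 8 − 2Σμ = 2m.
    let κ := (p : P) × Fin (e p)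
    let u : ι → κ → Bool := fun i k => decide ((k.2 : ℕ) < idx k.1 i)
    have hbound := card_le_of_agree_le u (4 - ∑ p ∈ P, μ p) (by omega) ?_ ?_
    · omega
    · simp only [κ, Fintype.card_sigma, Fintype.card_fin]
      rw [Finset.sum_coe_sort P (fun p => e p)]
      have : ∑ p ∈ P, q.disc.rootMultiplicity p ≤ ∑ p ∈ P, (e p + 2 * μ p) :=
        Finset.sum_le_sum fun p _ => he p
      rw [Finset.sum_add_distrib, ← Finset.mul_sum] at this
      omega
    · intro i j hij
      have hfib : ∀ p : ℂ, (Finset.univ.filter fun k : Fin (e p) =>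
          decide ((k : ℕ) < idx p i) = decide ((k : ℕ) < idx p j)).card + μ p
          ≤ (q.pol (v i) (v j)).rootMultiplicity p := by
        intro p
        have h1 := hchain p i j hij
        have h2 : (Finset.univ.filter fun k : Fin (e p) =>
            ¬ decide ((k : ℕ) < idx p i) = decide ((k : ℕ) < idx p j)).card
            = max (idx p i) (idx p j) - min (idx p i) (idx p j) := by
          rw [← Nat.card_Ico, ← Finset.card_map Fin.valEmbedding]
          congr 1
          ext k
          have := hidx p i
          have := hidx p j
          simp only [Finset.mem_map, Finset.mem_filter, Finset.mem_univ, true_and,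
            Fin.valEmbedding_apply, Finset.mem_Ico, decide_eq_decide]
          constructor
          · rintro ⟨k, hk, rfl⟩; omega
          · intro hk; exact ⟨⟨k, by omega⟩, by simp only; omega, rfl⟩
        have h3 := Finset.card_filter_add_card_filter_not (s := (Finset.univ : Finset (Fin (e p))))
          (fun k : Fin (e p) => decide ((k : ℕ) < idx p i) = decide ((k : ℕ) < idx p j))
        rw [Finset.card_univ, Fintype.card_fin] at h3
        omega
      have hcard : (Finset.univ.filter fun k : κ => u i k = u j k).card
          = ∑ p ∈ P, (Finset.univ.filter fun k : Fin (e p) =>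
            decide ((k : ℕ) < idx p i) = decide ((k : ℕ) < idx p j)).card := by
        rw [← Finset.sum_coe_sort P, ← Finset.card_sigma]
        congr 1
        ext ⟨p, k⟩
        rw [Finset.mem_sigma]
        simp [u]
      have := Finset.sum_le_sum fun p (_ : p ∈ P) => hfib p
      rw [Finset.sum_add_distrib, ← hcard] at this
      have := hBsum i j hij
      omega
  · right
    -- This product has degree Σμ ≥ 4 and divides every polar product; those have degree at most 4,
    -- so the quotients are constants.
    refine ⟨∏ p ∈ P, (Polynomial.X - Polynomial.C p) ^ μ p, fun i j => ?_⟩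
    by_cases hij : i = j
    · subst hij; exact ⟨0, by simp [hv]⟩
    have hdvd : ∏ p ∈ P, (Polynomial.X - Polynomial.C p) ^ μ p ∣ q.pol (v i) (v j) := by
      refine Finset.prod_dvd_of_coprime (fun a _ b _ hab =>
        (pairwise_coprime_X_sub_C Function.injective_id hab).pow) fun p _ => ?_
      exact (le_rootMultiplicity_iff (hB i j hij)).1 (hμ p i j hij)
    obtain ⟨r, hr⟩ := hdvd
    have hr0 : r ≠ 0 := by rintro rfl; exact hB i j hij (by simpa using hr)
    have hmonic : (∏ p ∈ P, (Polynomial.X - Polynomial.C p) ^ μ p).Monic :=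
      monic_prod_of_monic _ _ fun p _ => (monic_X_sub_C p).pow _
    have hnd : (∏ p ∈ P, (Polynomial.X - Polynomial.C p) ^ μ p).natDegree = ∑ p ∈ P, μ p := by
      rw [natDegree_prod_of_monic _ _ fun p _ => (monic_X_sub_C p).pow _]
      simp
    have h1 := hdeg i j
    rw [hr, hmonic.natDegree_mul' hr0, hnd] at h1
    obtain ⟨c, hc⟩ := natDegree_eq_zero.1 (show r.natDegree = 0 by omega)
    exact ⟨c, by rw [hr, ← hc, mul_comm]⟩

end TernaryForm

/-! ### Binary forms, and lines in degenerate conics -/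

/-- The value at `(s, t)` of the binary form of degree `d` with dehomogenization `P`. -/
def homEval (d : ℕ) (P : Polynomial ℂ) (s t : ℂ) : ℂ :=
  ∑ i ∈ Finset.range (d + 1), P.coeff i * s ^ i * t ^ (d - i)

theorem homEval_mul (d : ℕ) (P : Polynomial ℂ) (r s t : ℂ) :
    homEval d P (r * s) (r * t) = r ^ d * homEval d P s t := by
  rw [homEval, homEval, Finset.mul_sum]
  refine Finset.sum_congr rfl fun i hi => ?_
  have : d = i + (d - i) := by have := Finset.mem_range.1 hi; omega
  rw [show r ^ d = r ^ i * r ^ (d - i) by rw [← pow_add, ← this], mul_pow, mul_pow]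
  ring

theorem homEval_one_right {d : ℕ} {P : Polynomial ℂ} (hP : P.natDegree ≤ d) (s : ℂ) :
    homEval d P s 1 = P.eval s := by
  rw [Polynomial.eval_eq_sum_range' (n := d + 1) (by omega)]
  simp [homEval]

theorem homEval_one_zero (d : ℕ) (P : Polynomial ℂ) : homEval d P 1 0 = P.coeff d := by
  rw [homEval, Finset.sum_range_succ, Finset.sum_eq_zero]
  · simp
  · intro i hi
    have : d - i ≠ 0 := by have := Finset.mem_range.1 hi; omega
    simp [this]

namespace TernaryForm

/-- The specialization of a ternary form whose coefficients are binary forms of degrees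
`4, 3, 3, 2, 2, 2`. -/
def specialize (Q : TernaryForm (Polynomial ℂ)) (s t : ℂ) : TernaryForm ℂ :=
  ⟨homEval 4 Q.a s t, homEval 3 Q.b₁ s t, homEval 3 Q.b₂ s t, homEval 2 Q.c₁₁ s t,
    homEval 2 Q.c₁₂ s t, homEval 2 Q.c₂₂ s t⟩

theorem disc_specialize_mul (Q : TernaryForm (Polynomial ℂ)) (r s t : ℂ) :
    (Q.specialize (r * s) (r * t)).disc = r ^ 8 * (Q.specialize s t).disc := by
  simp only [specialize, disc, homEval_mul]; ring

/-- The quadratic form vanishes on the plane spanned by `(1, h₂, h₃)` and `(0, k₂, k₃)`. -/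
structure IsIsotropicPair {R : Type*} [CommRing R] (q : TernaryForm R) (h₂ h₃ k₂ k₃ : R) : Prop where
  val_left : q.val 1 h₂ h₃ = 0
  polar_eq : q.polar 1 h₂ h₃ 0 k₂ k₃ = 0
  val_right : q.val 0 k₂ k₃ = 0

end TernaryForm

theorem exists_quadratic_root {A B C : ℂ} (h : B ≠ 0 ∨ C ≠ 0) : ∃ x : ℂ, A + B * x + C * x ^ 2 = 0 := by
  by_cases hC : C = 0
  · have hB : B ≠ 0 := by tauto
    exact ⟨-A / B, by subst hC; field_simp; ring⟩
  · obtain ⟨δ, hδ⟩ := IsAlgClosed.exists_pow_nat_eq (B ^ 2 - 4 * C * A) (n := 2) (by norm_num)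
    refine ⟨(-B + δ) / (2 * C), ?_⟩
    field_simp
    linear_combination hδ

namespace TernaryForm

theorem exists_isotropic_zero (q : TernaryForm ℂ) :
    ∃ k₂ k₃ : ℂ, (k₂ ≠ 0 ∨ k₃ ≠ 0) ∧ q.val 0 k₂ k₃ = 0 := by
  by_cases h : q.c₁₁ = 0
  · exact ⟨1, 0, by simp, by simp [val, h]⟩
  · obtain ⟨x, hx⟩ := exists_quadratic_root (A := q.c₂₂) (B := q.c₁₂) (C := q.c₁₁) (Or.inr h)
    exact ⟨x, 1, by simp, by simp only [val]; linear_combination hx⟩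

/-- A degenerate conic contains a line other than `r = 0`, unless it is that line counted twice. -/
theorem exists_isotropicPair {q : TernaryForm ℂ} (hq : q.disc = 0)
    (hne : ¬ (q.b₁ = 0 ∧ q.b₂ = 0 ∧ q.c₁₁ = 0 ∧ q.c₁₂ = 0 ∧ q.c₂₂ = 0)) :
    ∃ h₂ h₃ k₂ k₃ : ℂ, (k₂ ≠ 0 ∨ k₃ ≠ 0) ∧ q.IsIsotropicPair h₂ h₃ k₂ k₃ := by
  have hdet : (!![2 * q.a, q.b₁, q.b₂; q.b₁, 2 * q.c₁₁, q.c₁₂; q.b₂, q.c₁₂, 2 * q.c₂₂]).det = 0 := by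
    rw [Matrix.det_fin_three]
    simp only [disc] at hq
    simp
    linear_combination 2 * hq
  obtain ⟨κ, hκ0, hκ⟩ := Matrix.exists_mulVec_eq_zero_iff.2 hdet
  have e0 := congrFun hκ 0
  have e1 := congrFun hκ 1
  have e2 := congrFun hκ 2
  simp [Matrix.mulVec, dotProduct, Fin.sum_univ_three] at e0 e1 e2
  -- `κ` is a singular point of the conic. If it is off r = 0, it is joined to any point of the
  -- conic on r = 0. If it lies on r = 0, it is joined to a point of the conic with r = 1, found on
  -- the line z = 0 or w = 0; the quadratic equation for it is soluble unless the conic is the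
  -- excluded one.
  by_cases h0 : κ 0 = 0
  · by_cases h1 : κ 1 = 0
    · have h2 : κ 2 ≠ 0 := by
        intro h2; apply hκ0; ext i; fin_cases i <;> simp [h0, h1, h2]
      simp only [h0, h1, mul_zero, zero_add, mul_eq_zero, h2, or_false, OfNat.ofNat_ne_zero,
        false_or] at e0 e1 e2
      obtain ⟨x, hx⟩ := exists_quadratic_root (A := q.a) (B := q.b₁) (C := q.c₁₁)
        (by by_contra hc; push Not at hc; exact hne ⟨hc.1, e0, hc.2, e1, e2⟩)
      exact ⟨x, 0, 0, 1, by simp, by simp only [val]; linear_combination hx,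
        by simp [polar, e0, e1, e2], by simp [val, e2]⟩
    · obtain ⟨x, hx⟩ := exists_quadratic_root (A := q.a) (B := q.b₂) (C := q.c₂₂) (by
        by_contra hc
        push Not at hc
        rw [hc.1, h0] at e0
        rw [hc.2, h0] at e2
        rw [h0] at e1
        have hb1 : q.b₁ = 0 := by simpa [h1] using e0
        have hc12 : q.c₁₂ = 0 := by simpa [h1] using e2
        rw [hc12] at e1
        have hc11 : q.c₁₁ = 0 := by simpa [h1] using e1
        exact hne ⟨hb1, hc.1, hc11, hc12, hc.2⟩)
      rw [h0] at e0 e1 e2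
      refine ⟨0, x, κ 1, κ 2, Or.inl h1, by simp only [val]; linear_combination hx, ?_, ?_⟩
      · simp only [polar]; linear_combination e0 + x * e2
      · simp only [val]; linear_combination (κ 1 * e1 + κ 2 * e2) / 2
  · obtain ⟨k₂, k₃, hk, hval⟩ := q.exists_isotropic_zero
    refine ⟨κ 1 / κ 0, κ 2 / κ 0, k₂, k₃, hk, ?_, ?_, hval⟩
    · simp only [val]; field_simp
      linear_combination (κ 0 * e0 + κ 1 * e1 + κ 2 * e2) / 2
    · simp only [polar]; field_simp
      linear_combination k₂ * e1 + k₃ * e2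

end TernaryForm

/-! ### Normal form along a double line -/

/-- `f` is a quartic form, double along `x₀ = x₁ = 0`, whose residual conics are given by `Q`. -/
structure IsNormalForm (f : MvPolynomial (Fin 4) ℂ) (Q : TernaryForm (Polynomial ℂ)) : Prop where
  a_le : Q.a.natDegree ≤ 4
  b₁_le : Q.b₁.natDegree ≤ 3
  b₂_le : Q.b₂.natDegree ≤ 3
  c₁₁_le : Q.c₁₁.natDegree ≤ 2
  c₁₂_le : Q.c₁₂.natDegree ≤ 2
  c₂₂_le : Q.c₂₂.natDegree ≤ 2
  eval_eq : ∀ x : Fin 4 → ℂ, eval x f = (Q.specialize (x 0) (x 1)).val 1 (x 2) (x 3)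

namespace IsNormalForm

variable {f : MvPolynomial (Fin 4) ℂ} {Q : TernaryForm (Polynomial ℂ)}

/-- The degrees 4, 3, 2 of the coefficients let r² split off: it is the double line r = 0 inside the
plane of slope (s : t), and the cofactor is the residual conic. -/
theorem eval_mul (h : IsNormalForm f Q) {x : Fin 4 → ℂ} {r s t : ℂ} (h0 : x 0 = r * s)
    (h1 : x 1 = r * t) : eval x f = r ^ 2 * (Q.specialize s t).val r (x 2) (x 3) := by
  rw [h.eval_eq, h0, h1]
  simp only [TernaryForm.specialize, TernaryForm.val, homEval_mul]
  ring

theorem specialize_one (h : IsNormalForm f Q) (τ : ℂ) : Q.specialize τ 1 =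
    ⟨Q.a.eval τ, Q.b₁.eval τ, Q.b₂.eval τ, Q.c₁₁.eval τ, Q.c₁₂.eval τ, Q.c₂₂.eval τ⟩ := by
  simp only [TernaryForm.specialize, homEval_one_right h.a_le, homEval_one_right h.b₁_le,
    homEval_one_right h.b₂_le, homEval_one_right h.c₁₁_le, homEval_one_right h.c₁₂_le,
    homEval_one_right h.c₂₂_le]

theorem eval_disc (h : IsNormalForm f Q) (τ : ℂ) :
    Q.disc.eval τ = (Q.specialize τ 1).disc := by
  simp [h.specialize_one, TernaryForm.disc]

/-- Each term of the discriminant has total degree bound 4 + 2 + 2 or 3 + 3 + 2, so its coefficient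
in degree 8 is the value of an octic form at (1 : 0). A smooth conic there forces degree exactly 8.
-/
theorem coeff_disc (h : IsNormalForm f Q) : Q.disc.coeff 8 = (Q.specialize 1 0).disc := by
  have h3 : ∀ {p q r : Polynomial ℂ} {a b c : ℕ}, p.natDegree ≤ a → q.natDegree ≤ b →
      r.natDegree ≤ c → a + b + c = 8 →
      (p * q * r).coeff 8 = p.coeff a * q.coeff b * r.coeff c := by
    intro p q r a b c hp hq hr habc
    rw [← habc, Polynomial.coeff_mul_add_eq_of_natDegree_le
      (Polynomial.natDegree_mul_le_of_le hp hq) hr,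
      Polynomial.coeff_mul_add_eq_of_natDegree_le hp hq]
  have e : Q.disc = Polynomial.C 4 * (Q.a * Q.c₁₁ * Q.c₂₂) + Q.b₁ * Q.b₂ * Q.c₁₂
      - Q.a * Q.c₁₂ * Q.c₁₂ - Q.c₁₁ * Q.b₂ * Q.b₂ - Q.c₂₂ * Q.b₁ * Q.b₁ := by
    simp only [TernaryForm.disc, map_ofNat]; ring
  rw [e, Polynomial.coeff_sub, Polynomial.coeff_sub, Polynomial.coeff_sub, Polynomial.coeff_add,
    Polynomial.coeff_C_mul, h3 h.a_le h.c₁₁_le h.c₂₂_le rfl, h3 h.b₁_le h.b₂_le h.c₁₂_le rfl,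
    h3 h.a_le h.c₁₂_le h.c₁₂_le rfl, h3 h.c₁₁_le h.b₂_le h.b₂_le rfl,
    h3 h.c₂₂_le h.b₁_le h.b₁_le rfl]
  simp only [TernaryForm.specialize, TernaryForm.disc, homEval_one_zero]
  ring

theorem natDegree_disc_le (h : IsNormalForm f Q) : Q.disc.natDegree ≤ 8 := by
  have h3 : ∀ {p q r : Polynomial ℂ} {a b c : ℕ}, p.natDegree ≤ a → q.natDegree ≤ b →
      r.natDegree ≤ c → a + b + c ≤ 8 → (p * q * r).natDegree ≤ 8 := fun hp hq hr habc =>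
    (Polynomial.natDegree_mul_le_of_le (Polynomial.natDegree_mul_le_of_le hp hq) hr).trans habc
  have e : Q.disc = Polynomial.C 4 * (Q.a * Q.c₁₁ * Q.c₂₂) + Q.b₁ * Q.b₂ * Q.c₁₂
      - Q.a * Q.c₁₂ * Q.c₁₂ - Q.c₁₁ * Q.b₂ * Q.b₂ - Q.c₂₂ * Q.b₁ * Q.b₁ := by
    simp only [TernaryForm.disc, map_ofNat]; ring
  have hsub : ∀ {p q : Polynomial ℂ}, p.natDegree ≤ 8 → q.natDegree ≤ 8 → (p - q).natDegree ≤ 8 :=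
    fun hp hq => (Polynomial.natDegree_sub_le _ _).trans (max_le hp hq)
  have hadd : ∀ {p q : Polynomial ℂ}, p.natDegree ≤ 8 → q.natDegree ≤ 8 → (p + q).natDegree ≤ 8 :=
    fun hp hq => (Polynomial.natDegree_add_le _ _).trans (max_le hp hq)
  rw [e]
  refine hsub (hsub (hsub (hadd ((Polynomial.natDegree_C_mul_le _ _).trans ?_) ?_) ?_) ?_) ?_
  · exact h3 h.a_le h.c₁₁_le h.c₂₂_le le_rfl
  · exact h3 h.b₁_le h.b₂_le h.c₁₂_le le_rfl
  · exact h3 h.a_le h.c₁₂_le h.c₁₂_le le_rfl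
  · exact h3 h.c₁₁_le h.b₂_le h.b₂_le le_rfl
  · exact h3 h.c₂₂_le h.b₁_le h.b₁_le le_rfl

theorem natDegree_disc (h : IsNormalForm f Q) (h0 : (Q.specialize 1 0).disc ≠ 0) :
    Q.disc.natDegree = 8 :=
  le_antisymm h.natDegree_disc_le (Polynomial.le_natDegree_of_ne_zero (by rwa [h.coeff_disc]))

end IsNormalForm

/-! ### Linear algebra of planes -/

section Planes

variable {V : Type*} [AddCommGroup V] [Module ℂ V]

theorem finrank_span_pair_eq_two {u v : V} (h : ∀ a b : ℂ, a • u + b • v = 0 → a = 0 ∧ b = 0) :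
    Module.finrank ℂ (Submodule.span ℂ {u, v}) = 2 := by
  have hl : LinearIndependent ℂ ![u, v] := LinearIndependent.pair_iff.2 h
  have := finrank_span_eq_card hl
  rwa [Matrix.range_cons_cons_empty, Fintype.card_fin] at this

theorem eq_span_pair_of_finrank_eq_two {L : Submodule ℂ V} (hL : Module.finrank ℂ L = 2)
    {u v : V} (hu : u ∈ L) (hv : v ∈ L) (h : ∀ a b : ℂ, a • u + b • v = 0 → a = 0 ∧ b = 0) :
    L = Submodule.span ℂ {u, v} := by
  have : FiniteDimensional ℂ L := Module.finite_of_finrank_pos (by omega)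
  refine (Submodule.eq_of_le_of_finrank_eq ?_ ?_).symm
  · rw [Submodule.span_le]
    rintro x (rfl | rfl)
    exacts [hu, hv]
  · rw [hL, finrank_span_pair_eq_two h]

variable [FiniteDimensional ℂ V]

/-- A symmetric bilinear form with three totally isotropic planes in a space of dimension at most
three vanishes on this space. -/
theorem eq_zero_of_three_isotropic_planes (B : V →ₗ[ℂ] V →ₗ[ℂ] ℂ) (hB : ∀ x y, B x y = B y x)
    {H P₁ P₂ P₃ : Submodule ℂ V} (hH : Module.finrank ℂ H ≤ 3)
    (h₁ : P₁ ≤ H) (h₂ : P₂ ≤ H) (h₃ : P₃ ≤ H)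
    (d₁ : Module.finrank ℂ P₁ = 2) (d₂ : Module.finrank ℂ P₂ = 2) (d₃ : Module.finrank ℂ P₃ = 2)
    (h₁₂ : P₁ ≠ P₂) (h₁₃ : P₁ ≠ P₃) (h₂₃ : P₂ ≠ P₃)
    (i₁ : ∀ x ∈ P₁, ∀ y ∈ P₁, B x y = 0) (i₂ : ∀ x ∈ P₂, ∀ y ∈ P₂, B x y = 0)
    (i₃ : ∀ x ∈ P₃, ∀ y ∈ P₃, B x y = 0) :
    ∀ x ∈ H, ∀ y ∈ H, B x y = 0 := by
  have hnot : ∀ {P P' : Submodule ℂ V}, Module.finrank ℂ P = 2 → Module.finrank ℂ P' = 2 →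
      P ≠ P' → ∃ x ∈ P, x ∉ P' := by
    intro P P' hP hP' hne
    by_contra hc
    push Not at hc
    exact hne (Submodule.eq_of_le_of_finrank_eq hc (by omega))
  have hdim := Submodule.finrank_sup_add_finrank_inf_eq P₁ P₂
  have hlt : Module.finrank ℂ (P₁ ⊓ P₂ : Submodule ℂ V) < 2 := by
    obtain ⟨x, hx, hx'⟩ := hnot d₁ d₂ h₁₂
    rw [← d₁]
    exact Submodule.finrank_lt_finrank_of_lt (lt_of_le_of_ne inf_le_left fun h =>
      hx' (inf_eq_left.1 h hx))
  have hle := Submodule.finrank_mono (sup_le h₁ h₂)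
  have hsup : P₁ ⊔ P₂ = H := Submodule.eq_of_le_of_finrank_eq (sup_le h₁ h₂) (by omega)
  obtain ⟨k, hk, hk0⟩ : ∃ k ∈ P₁ ⊓ P₂, k ≠ 0 := by
    apply Submodule.exists_mem_ne_zero_of_ne_bot
    intro h
    rw [h, finrank_bot] at hdim
    omega
  obtain ⟨c, hc, hc₁, hc₂⟩ : ∃ c ∈ P₃, c ∉ P₁ ∧ c ∉ P₂ := by
    obtain ⟨x, hx, hx'⟩ := hnot d₃ d₁ h₁₃.symm
    obtain ⟨y, hy, hy'⟩ := hnot d₃ d₂ h₂₃.symm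
    by_cases hx2 : x ∈ P₂
    · by_cases hy1 : y ∈ P₁
      · exact ⟨x + y, P₃.add_mem hx hy, fun h => hx' ((P₁.add_mem_iff_left hy1).1 h),
          fun h => hy' ((P₂.add_mem_iff_right hx2).1 h)⟩
      · exact ⟨y, hy, hy1, hy'⟩
    · exact ⟨x, hx, hx', hx2⟩
  obtain ⟨u, hu, v, hv, rfl⟩ := Submodule.mem_sup.1 (hsup ▸ h₃ hc : c ∈ P₁ ⊔ P₂)
  have hu2 : u ∉ P₂ := fun h => hc₂ (P₂.add_mem h hv)
  have hv1 : v ∉ P₁ := fun h => hc₁ (P₁.add_mem hu h)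
  have hind : ∀ {P : Submodule ℂ V} {w : V}, k ∈ P → w ∉ P →
      ∀ a b : ℂ, a • k + b • w = 0 → a = 0 ∧ b = 0 := by
    intro P w hkP hw a b hab
    have hb : b = 0 := by
      by_contra hb
      apply hw
      have h1 : b • w ∈ P := by
        rw [eq_neg_of_add_eq_zero_right hab]
        exact P.neg_mem (P.smul_mem _ hkP)
      exact (P.smul_mem_iff hb).1 h1
    subst hb
    simpa [hk0] using hab
  have s₁ := eq_span_pair_of_finrank_eq_two d₁ hk.1 hu (hind hk.2 hu2)
  have s₂ := eq_span_pair_of_finrank_eq_two d₂ hk.2 hv (hind hk.1 hv1)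
  -- With P₁ = ⟨k, u⟩, P₂ = ⟨k, v⟩ and u + v in P₃, B(u + v, u + v) = 2 B(u, v). This is the only
  -- product not already controlled by P₁ and P₂.
  have huv : B u v = 0 := by
    have := i₃ _ hc _ hc
    simp only [map_add, LinearMap.add_apply, i₁ u hu u hu, i₂ v hv v hv, hB v u] at this
    have h2 : (2 : ℂ) * B u v = 0 := by linear_combination this
    simpa using h2
  have cross : ∀ x ∈ P₁, ∀ y ∈ P₂, B x y = 0 := by
    intro x hx y hy
    rw [s₁] at hx
    rw [s₂] at hy
    obtain ⟨a, b, rfl⟩ := Submodule.mem_span_pair.1 hx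
    obtain ⟨a', b', rfl⟩ := Submodule.mem_span_pair.1 hy
    simp [i₁ k hk.1 k hk.1, huv, i₂ k hk.2 v hv, i₁ u hu k hk.1]
  intro x hx y hy
  rw [← hsup] at hx hy
  obtain ⟨x₁, hx₁, x₂, hx₂, rfl⟩ := Submodule.mem_sup.1 hx
  obtain ⟨y₁, hy₁, y₂, hy₂, rfl⟩ := Submodule.mem_sup.1 hy
  simp [i₁ x₁ hx₁ y₁ hy₁, i₂ x₂ hx₂ y₂ hy₂, cross x₁ hx₁ y₂ hy₂, hB x₂ y₁, cross y₁ hy₁ x₂ hx₂]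

end Planes

/-! ### Lines of projective space relative to the axis -/

/-- The line `x₀ = x₁ = 0`. -/
def axis : Submodule ℂ (Fin 4 → ℂ) := Submodule.span ℂ {![0, 0, 1, 0], ![0, 0, 0, 1]}

/-- The line through `(s, t, h₂, h₃)` and the point `(0, 0, k₂, k₃)` of the axis. -/
def secant (s t h₂ h₃ k₂ k₃ : ℂ) : Submodule ℂ (Fin 4 → ℂ) :=
  Submodule.span ℂ {![s, t, h₂, h₃], ![0, 0, k₂, k₃]}

/-- The line `x₂ = p₀ x₀ + p₁ x₁`, `x₃ = p₂ x₀ + p₃ x₁`. -/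
def graphLine (p : Fin 4 → ℂ) : Submodule ℂ (Fin 4 → ℂ) :=
  Submodule.span ℂ {![1, 0, p 0, p 2], ![0, 1, p 1, p 3]}

theorem mem_axis {x : Fin 4 → ℂ} : x ∈ axis ↔ x 0 = 0 ∧ x 1 = 0 := by
  rw [axis, Submodule.mem_span_pair]
  constructor
  · rintro ⟨a, b, rfl⟩; simp
  · rintro ⟨h0, h1⟩
    refine ⟨x 2, x 3, ?_⟩
    ext i; fin_cases i <;> simp [h0, h1]

theorem mem_graphLine {p x : Fin 4 → ℂ} :
    x ∈ graphLine p ↔ x 2 = p 0 * x 0 + p 1 * x 1 ∧ x 3 = p 2 * x 0 + p 3 * x 1 := by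
  rw [graphLine, Submodule.mem_span_pair]
  constructor
  · rintro ⟨a, b, rfl⟩; simp [mul_comm]
  · rintro ⟨h0, h1⟩
    refine ⟨x 0, x 1, ?_⟩
    ext i; fin_cases i <;> simp [h0, h1, mul_comm]

theorem isLine_axis : IsLine axis := by
  refine finrank_span_pair_eq_two fun a b h => ?_
  have h2 := congrFun h 2
  have h3 := congrFun h 3
  simp at h2 h3
  exact ⟨h2, h3⟩

theorem isLine_graphLine (p : Fin 4 → ℂ) : IsLine (graphLine p) := by
  refine finrank_span_pair_eq_two fun a b h => ?_
  have h2 := congrFun h 0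
  have h3 := congrFun h 1
  simp at h2 h3
  exact ⟨h2, h3⟩

theorem secant_independent {s t h₂ h₃ k₂ k₃ : ℂ} (hst : s ≠ 0 ∨ t ≠ 0) (hk : k₂ ≠ 0 ∨ k₃ ≠ 0)
    (a b : ℂ) (h : a • ![s, t, h₂, h₃] + b • ![0, 0, k₂, k₃] = 0) : a = 0 ∧ b = 0 := by
  have e0 := congrFun h 0
  have e1 := congrFun h 1
  have e2 := congrFun h 2
  have e3 := congrFun h 3
  simp at e0 e1 e2 e3
  have ha : a = 0 := by tauto
  subst ha
  simp at e2 e3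
  exact ⟨rfl, by tauto⟩

theorem isLine_secant {s t h₂ h₃ k₂ k₃ : ℂ} (hst : s ≠ 0 ∨ t ≠ 0) (hk : k₂ ≠ 0 ∨ k₃ ≠ 0) :
    IsLine (secant s t h₂ h₃ k₂ k₃) :=
  finrank_span_pair_eq_two (secant_independent hst hk)

theorem graphLine_injective : Function.Injective graphLine := by
  intro p p' h
  have h1 : ![1, 0, p 0, p 2] ∈ graphLine p' := by rw [← h, mem_graphLine]; simp
  have h2 : ![0, 1, p 1, p 3] ∈ graphLine p' := by rw [← h, mem_graphLine]; simp
  rw [mem_graphLine] at h1 h2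
  simp at h1 h2
  ext i; fin_cases i <;> simp [h1, h2]

/-- The projection (x₀, x₁) restricted to L has rank 0, 1 or 2: L is the axis, meets it in a point,
or is skew to it. -/
theorem line_cases {L : Submodule ℂ (Fin 4 → ℂ)} (hL : IsLine L) :
    L = axis ∨ (∃ s t h₂ h₃ k₂ k₃ : ℂ, (s ≠ 0 ∨ t ≠ 0) ∧ (k₂ ≠ 0 ∨ k₃ ≠ 0) ∧
      L = secant s t h₂ h₃ k₂ k₃) ∨ ∃ p, L = graphLine p := by
  have hL' : Module.finrank ℂ L = 2 := hL
  let φ : L →ₗ[ℂ] (Fin 2 → ℂ) :=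
    LinearMap.pi ![LinearMap.proj 0 ∘ₗ L.subtype, LinearMap.proj 1 ∘ₗ L.subtype]
  have hφ0 : ∀ x : L, φ x 0 = (x : Fin 4 → ℂ) 0 := fun x => rfl
  have hφ1 : ∀ x : L, φ x 1 = (x : Fin 4 → ℂ) 1 := fun x => rfl
  by_cases hinj : Function.Injective φ
  · have hsurj : Function.Surjective φ :=
      (LinearMap.injective_iff_surjective_of_finrank_eq_finrank (by simp [hL'])).1 hinj
    obtain ⟨u, hu⟩ := hsurj ![1, 0]
    obtain ⟨v, hv⟩ := hsurj ![0, 1]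
    have u0 : (u : Fin 4 → ℂ) 0 = 1 := by rw [← hφ0, hu]; rfl
    have u1 : (u : Fin 4 → ℂ) 1 = 0 := by rw [← hφ1, hu]; rfl
    have v0 : (v : Fin 4 → ℂ) 0 = 0 := by rw [← hφ0, hv]; rfl
    have v1 : (v : Fin 4 → ℂ) 1 = 1 := by rw [← hφ1, hv]; rfl
    right; right
    refine ⟨![u.1 2, v.1 2, u.1 3, v.1 3], ?_⟩
    refine (eq_span_pair_of_finrank_eq_two hL' u.2 v.2 ?_).trans ?_
    rotate_left
    · rw [graphLine]
      congr 2
      · ext i; fin_cases i <;> simp [u0, u1]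
      · congr 1; ext i; fin_cases i <;> simp [v0, v1]
    · intro a b h
      have h0 := congrFun h 0
      have h1 := congrFun h 1
      simp [u0, u1, v0, v1] at h0 h1
      exact ⟨h0, h1⟩
  · have hker : LinearMap.ker φ ≠ ⊥ := fun h => hinj (LinearMap.ker_eq_bot.1 h)
    obtain ⟨k, hk, hk0⟩ := Submodule.exists_mem_ne_zero_of_ne_bot hker
    have k0 : (k : Fin 4 → ℂ) 0 = 0 := by rw [← hφ0, LinearMap.mem_ker.1 hk]; rfl
    have k1 : (k : Fin 4 → ℂ) 1 = 0 := by rw [← hφ1, LinearMap.mem_ker.1 hk]; rfl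
    have k23 : k.1 2 ≠ 0 ∨ k.1 3 ≠ 0 := by
      by_contra hc
      push Not at hc
      apply hk0
      ext i; fin_cases i <;> simp [k0, k1, hc]
    by_cases hax : L ≤ axis
    · exact Or.inl (Submodule.eq_of_le_of_finrank_eq hax (hL'.trans isLine_axis.symm))
    · obtain ⟨h, hhL, hh⟩ := Set.not_subset.1 hax
      right; left
      have hh' : h 0 ≠ 0 ∨ h 1 ≠ 0 := by
        by_contra hc
        push Not at hc
        exact hh (mem_axis.2 hc)
      refine ⟨h 0, h 1, h 2, h 3, k.1 2, k.1 3, hh', k23, ?_⟩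
      have e1 : ![h 0, h 1, h 2, h 3] = h := by ext i; fin_cases i <;> rfl
      have e2 : ![0, 0, k.1 2, k.1 3] = k.1 := by ext i; fin_cases i <;> simp [k0, k1]
      refine eq_span_pair_of_finrank_eq_two hL' ?_ ?_ (secant_independent hh' k23)
      · rwa [e1]
      · rw [e2]; exact k.2

theorem secant_smul {s t h₂ h₃ k₂ k₃ r : ℂ} (hr : r ≠ 0) (hst : s ≠ 0 ∨ t ≠ 0)
    (hk : k₂ ≠ 0 ∨ k₃ ≠ 0) :
    secant s t h₂ h₃ k₂ k₃ = secant (r * s) (r * t) (r * h₂) (r * h₃) k₂ k₃ := by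
  refine eq_span_pair_of_finrank_eq_two (isLine_secant hst hk)
    (Submodule.mem_span_pair.2 ⟨r, 0, by simp⟩) (Submodule.mem_span_pair.2 ⟨0, 1, by simp⟩)
    (secant_independent ?_ hk)
  simpa [hr] using hst

/-! ### Lines meeting the axis, and ruledness -/

namespace IsNormalForm

variable {f : MvPolynomial (Fin 4) ℂ} {Q : TernaryForm (Polynomial ℂ)}

/-- On the secant f is a² times a binary quadratic form in (a, b); the factor a² comes from the
axis, and the three coefficients of the quadratic form are the conditions of `IsIsotropicPair`. -/
theorem secant_mem_linesOn_iff (h : IsNormalForm f Q) {s t h₂ h₃ k₂ k₃ : ℂ} (hst : s ≠ 0 ∨ t ≠ 0)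
    (hk : k₂ ≠ 0 ∨ k₃ ≠ 0) : secant s t h₂ h₃ k₂ k₃ ∈ linesOn f ↔
      (Q.specialize s t).IsIsotropicPair h₂ h₃ k₂ k₃ := by
  have hev : ∀ a b : ℂ, eval (a • ![s, t, h₂, h₃] + b • ![0, 0, k₂, k₃]) f =
      a ^ 2 * (a ^ 2 * (Q.specialize s t).val 1 h₂ h₃
        + a * b * (Q.specialize s t).polar 1 h₂ h₃ 0 k₂ k₃
        + b ^ 2 * (Q.specialize s t).val 0 k₂ k₃) := by
    intro a b
    rw [h.eval_mul (r := a) (s := s) (t := t) (by simp) (by simp)]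
    simp only [TernaryForm.val, TernaryForm.polar, Pi.add_apply, Pi.smul_apply, smul_eq_mul,
      Matrix.cons_val]
    ring
  constructor
  · rintro ⟨-, hL⟩
    have hz : ∀ b : ℂ, (Q.specialize s t).val 1 h₂ h₃
        + b * (Q.specialize s t).polar 1 h₂ h₃ 0 k₂ k₃
        + b ^ 2 * (Q.specialize s t).val 0 k₂ k₃ = 0 := by
      intro b
      have := hL _ (Submodule.mem_span_pair.2 ⟨1, b, rfl⟩)
      rw [hev] at this
      linear_combination this
    have e0 := hz 0
    have e1 := hz 1
    have e2 := hz (-1)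
    exact ⟨by linear_combination e0, by linear_combination (e1 - e2) / 2,
      by linear_combination (e1 + e2) / 2 - e0⟩
  · intro hq
    refine ⟨isLine_secant hst hk, fun x hx => ?_⟩
    obtain ⟨a, b, rfl⟩ := Submodule.mem_span_pair.1 hx
    rw [hev, hq.val_left, hq.polar_eq, hq.val_right]
    ring

theorem secant_slope_eq {τ τ' h₂ h₃ k₂ k₃ h₂' h₃' k₂' k₃' : ℂ}
    (h : secant τ 1 h₂ h₃ k₂ k₃ = secant τ' 1 h₂' h₃' k₂' k₃') : τ = τ' := by
  have h1 : ![τ, 1, h₂, h₃] ∈ secant τ' 1 h₂' h₃' k₂' k₃' := by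
    rw [← h]; exact Submodule.subset_span (by simp)
  obtain ⟨a, b, hab⟩ := Submodule.mem_span_pair.1 h1
  have e0 := congrFun hab 0
  have e1 := congrFun hab 1
  simp at e0 e1
  rw [← e0, e1, one_mul]

/-- A plane contained in the surface contains infinitely many lines. -/
theorem infinite_of_plane (h : IsNormalForm f Q) {s t : ℂ} (hst : s ≠ 0 ∨ t ≠ 0)
    (hq : ∀ r z w, (Q.specialize s t).val r z w = 0) : (linesOn f).Infinite := by
  refine Set.infinite_of_injective_forall_mem (f := fun l : ℂ => secant s t l 0 0 1) ?_ ?_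
  · intro l l' hl
    have h1 : ![s, t, l, 0] ∈ secant s t l' 0 0 1 := by
      have hl' : secant s t l 0 0 1 = secant s t l' 0 0 1 := hl
      rw [← hl']; exact Submodule.subset_span (by simp)
    obtain ⟨a, b, hab⟩ := Submodule.mem_span_pair.1 h1
    have e0 := congrFun hab 0
    have e1 := congrFun hab 1
    have e2 := congrFun hab 2
    simp at e0 e1 e2
    have ha : a = 1 := by
      rcases hst with hs | ht
      · exact (mul_eq_right₀ hs).1 e0
      · exact (mul_eq_right₀ ht).1 e1
    rw [← e2, ha, one_mul]
  · intro l
    refine (h.secant_mem_linesOn_iff hst (by simp)).2 ⟨hq _ _ _, ?_, hq _ _ _⟩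
    have e1 := hq 1 l 1
    have e2 := hq 1 l 0
    have e3 := hq 0 0 1
    simp only [TernaryForm.val, TernaryForm.polar] at *
    linear_combination e1 - e2 - e3

/-- If all residual conics are degenerate, then the surface is ruled. -/
theorem infinite_of_disc_eq_zero (h : IsNormalForm f Q)
    (hdisc : ∀ s t, (Q.specialize s t).disc = 0) : (linesOn f).Infinite := by
  by_cases hz : Q.b₁ = 0 ∧ Q.b₂ = 0 ∧ Q.c₁₁ = 0 ∧ Q.c₁₂ = 0 ∧ Q.c₂₂ = 0
  -- Here f is a binary quartic in (x₀, x₁), so any zero of it, possibly at infinity, gives a plane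
  -- in the surface.
  · obtain ⟨h1, h2, h3, h4, h5⟩ := hz
    obtain ⟨s, t, hst, ha⟩ : ∃ s t : ℂ, (s ≠ 0 ∨ t ≠ 0) ∧ homEval 4 Q.a s t = 0 := by
      by_cases h4 : Q.a.coeff 4 = 0
      · exact ⟨1, 0, by simp, by rw [homEval_one_zero, h4]⟩
      · have hd : Q.a.degree ≠ 0 := by
          intro hd
          rw [Polynomial.coeff_eq_zero_of_degree_lt (by rw [hd]; norm_num)] at h4
          exact h4 rfl
        obtain ⟨τ, hτ⟩ := IsAlgClosed.exists_root Q.a hd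
        exact ⟨τ, 1, by simp, by rw [homEval_one_right h.a_le]; exact hτ⟩
    refine h.infinite_of_plane hst fun r z w => ?_
    have hzero : ∀ d, homEval d 0 s t = 0 := fun d => by simp [homEval]
    simp [TernaryForm.specialize, TernaryForm.val, ha, h1, h2, h3, h4, h5, hzero]
  -- `P` is a non-zero coefficient of `Q` other than `a`. Away from its roots the conic is not the
  -- doubled line r = 0, so it yields a line, and different slopes yield different lines.
  · obtain ⟨P, hP, hPτ⟩ : ∃ P : Polynomial ℂ, P ≠ 0 ∧ ∀ τ, P.eval τ ≠ 0 →
        ¬ ((Q.specialize τ 1).b₁ = 0 ∧ (Q.specialize τ 1).b₂ = 0 ∧ (Q.specialize τ 1).c₁₁ = 0 ∧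
          (Q.specialize τ 1).c₁₂ = 0 ∧ (Q.specialize τ 1).c₂₂ = 0) := by
      simp only [h.specialize_one]
      by_contra hc
      push Not at hc
      apply hz
      refine ⟨?_, ?_, ?_, ?_, ?_⟩ <;> by_contra hne <;> obtain ⟨τ, h1, h2⟩ := hc _ hne <;> tauto
    have hinf : {τ : ℂ | P.eval τ ≠ 0}.Infinite := by
      have : {τ : ℂ | P.eval τ ≠ 0} = (P.roots.toFinset : Set ℂ)ᶜ := by
        ext τ; simp [hP]
      rw [this]
      exact (Finset.finite_toSet _).infinite_compl
    have hex : ∀ τ : ℂ, ∃ L : Submodule ℂ (Fin 4 → ℂ), P.eval τ ≠ 0 → L ∈ linesOn f ∧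
        ∃ h₂ h₃ k₂ k₃, L = secant τ 1 h₂ h₃ k₂ k₃ := by
      intro τ
      by_cases hτ : P.eval τ = 0
      · exact ⟨⊥, fun h => absurd hτ h⟩
      · obtain ⟨h₂, h₃, k₂, k₃, hk, hq⟩ :=
          TernaryForm.exists_isotropicPair (hdisc τ 1) (hPτ τ hτ)
        exact ⟨_, fun _ => ⟨(h.secant_mem_linesOn_iff (by simp) hk).2 hq, h₂, h₃, k₂, k₃, rfl⟩⟩
    choose L hL using hex
    refine Set.infinite_of_injOn_mapsTo (f := L) ?_ (fun τ hτ => (hL τ hτ).1) hinf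
    intro τ hτ τ' hτ' he
    obtain ⟨-, h₂, h₃, k₂, k₃, e⟩ := hL τ hτ
    obtain ⟨-, h₂', h₃', k₂', k₃', e'⟩ := hL τ' hτ'
    rw [e, e'] at he
    exact secant_slope_eq he

end IsNormalForm

/-! ### Lines skew to the axis -/

/-- The line `graphLine p` as a vector of linear polynomials, in the chart `(x₀, x₁) = (X, 1)`. -/
noncomputable def graphVec (p : Fin 4 → ℂ) : Polynomial ℂ × Polynomial ℂ :=
  (Polynomial.C (p 0) * Polynomial.X + Polynomial.C (p 1),
    Polynomial.C (p 2) * Polynomial.X + Polynomial.C (p 3))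

theorem graphVec_injective : Function.Injective graphVec := by
  intro p p' h
  have h1 := congrArg Prod.fst h
  have h2 := congrArg Prod.snd h
  simp only [graphVec] at h1 h2
  have a0 := congrArg (fun P => Polynomial.coeff P 0) h1
  have a1 := congrArg (fun P => Polynomial.coeff P 1) h1
  have b0 := congrArg (fun P => Polynomial.coeff P 0) h2
  have b1 := congrArg (fun P => Polynomial.coeff P 1) h2
  simp at a0 a1 b0 b1
  ext i; fin_cases i <;> simp [a0, a1, b0, b1]

namespace IsNormalForm

variable {f : MvPolynomial (Fin 4) ℂ} {Q : TernaryForm (Polynomial ℂ)}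

theorem eval_val (h : IsNormalForm f Q) (p : Fin 4 → ℂ) (τ : ℂ) :
    (Q.val 1 (graphVec p).1 (graphVec p).2).eval τ
      = eval ![τ, 1, p 0 * τ + p 1, p 2 * τ + p 3] f := by
  rw [h.eval_eq]
  simp [h.specialize_one, TernaryForm.val, graphVec]

theorem graphLine_mem_linesOn_iff (h : IsNormalForm f Q) (p : Fin 4 → ℂ) :
    graphLine p ∈ linesOn f ↔ Q.val 1 (graphVec p).1 (graphVec p).2 = 0 := by
  constructor
  · rintro ⟨-, hL⟩
    refine Polynomial.funext fun τ => ?_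
    rw [h.eval_val, Polynomial.eval_zero]
    exact hL _ (mem_graphLine.2 (by simp))
  · intro hq
    refine ⟨isLine_graphLine p, fun x hx => ?_⟩
    have h1 : ∀ t ≠ 0, eval ![x 0, t, p 0 * x 0 + p 1 * t, p 2 * x 0 + p 3 * t] f = 0 := by
      intro t ht
      have e := h.eval_val p (x 0 / t)
      rw [hq, Polynomial.eval_zero, h.eval_eq] at e
      rw [h.eval_mul (r := t) (s := x 0 / t) (t := 1) (by simp; field_simp) (by simp)]
      simp only [TernaryForm.val, Matrix.cons_val] at e ⊢
      have hx0 : x 0 = x 0 / t * t := (div_mul_cancel₀ _ ht).symm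
      generalize x 0 / t = u at e hx0 ⊢
      rw [hx0]
      linear_combination -t ^ 4 * e
    -- The chart (X, 1) only sees points with x₁ ≠ 0; continuity supplies the remaining ones.
    have hc : Continuous fun t : ℂ =>
        eval ![x 0, t, p 0 * x 0 + p 1 * t, p 2 * x 0 + p 3 * t] f := by
      refine (MvPolynomial.continuous_eval f).comp (continuous_pi fun i => ?_)
      fin_cases i <;> simp <;> fun_prop
    have h2 := Continuous.ext_on (dense_compl_singleton (0 : ℂ)) hc (continuous_const (y := 0))
      (fun t ht => h1 t ht)
    have h3 := congrFun h2 (x 1)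
    obtain ⟨e2, e3⟩ := mem_graphLine.1 hx
    have hx' : ![x 0, x 1, p 0 * x 0 + p 1 * x 1, p 2 * x 0 + p 3 * x 1] = x := by
      ext i; fin_cases i <;> simp [e2, e3]
    rwa [hx'] at h3

/-- For isotropic v, v′ the polar product is −q(v − v′). As v − v′ has first coordinate 0, only the
coefficients c of degree 2 enter, each times two linear factors. -/
theorem natDegree_pol_le (h : IsNormalForm f Q) {p p' : Fin 4 → ℂ}
    (hp : Q.val 1 (graphVec p).1 (graphVec p).2 = 0)
    (hp' : Q.val 1 (graphVec p').1 (graphVec p').2 = 0) :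
    (Q.pol (graphVec p) (graphVec p')).natDegree ≤ 4 := by
  have e : Q.pol (graphVec p) (graphVec p') =
      -(Q.c₁₁ * (((graphVec p).1 - (graphVec p').1) * ((graphVec p).1 - (graphVec p').1))
        + Q.c₁₂ * (((graphVec p).1 - (graphVec p').1) * ((graphVec p).2 - (graphVec p').2))
        + Q.c₂₂ * (((graphVec p).2 - (graphVec p').2) * ((graphVec p).2 - (graphVec p').2))) := by
    simp only [TernaryForm.pol, TernaryForm.polar, TernaryForm.val] at *
    linear_combination hp + hp'
  have d1 : ∀ a b a' b' : ℂ, ((Polynomial.C a * Polynomial.X + Polynomial.C b)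
      - (Polynomial.C a' * Polynomial.X + Polynomial.C b')).natDegree ≤ 1 := fun a b a' b' =>
    (Polynomial.natDegree_sub_le _ _).trans
      (max_le Polynomial.natDegree_linear_le Polynomial.natDegree_linear_le)
  have h3 : ∀ {c u v : Polynomial ℂ}, c.natDegree ≤ 2 → u.natDegree ≤ 1 → v.natDegree ≤ 1 →
      (c * (u * v)).natDegree ≤ 4 := fun hc hu hv =>
    Polynomial.natDegree_mul_le_of_le hc (Polynomial.natDegree_mul_le_of_le hu hv)
  have hadd : ∀ {p q : Polynomial ℂ}, p.natDegree ≤ 4 → q.natDegree ≤ 4 → (p + q).natDegree ≤ 4 :=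
    fun hp hq => (Polynomial.natDegree_add_le _ _).trans (max_le hp hq)
  rw [e, Polynomial.natDegree_neg]
  exact hadd (hadd (h3 h.c₁₁_le (d1 _ _ _ _) (d1 _ _ _ _))
    (h3 h.c₁₂_le (d1 _ _ _ _) (d1 _ _ _ _))) (h3 h.c₂₂_le (d1 _ _ _ _) (d1 _ _ _ _))

/-- Three skew lines with proportional polar products span a conic of lines. -/
theorem infinite_of_proportional (h : IsNormalForm f Q) {p₁ p₂ p₃ : Fin 4 → ℂ}
    (h₁ : Q.val 1 (graphVec p₁).1 (graphVec p₁).2 = 0)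
    (h₂ : Q.val 1 (graphVec p₂).1 (graphVec p₂).2 = 0)
    (h₃ : Q.val 1 (graphVec p₃).1 (graphVec p₃).2 = 0)
    (hT : TernaryForm.area (graphVec p₁) (graphVec p₂) (graphVec p₃) ≠ 0)
    {g : Polynomial ℂ} {c₁₂ c₁₃ c₂₃ : ℂ} (h₁₂ : c₁₂ ≠ 0) (h₁₃ : c₁₃ ≠ 0)
    (e₁₂ : Q.pol (graphVec p₁) (graphVec p₂) = Polynomial.C c₁₂ * g)
    (e₁₃ : Q.pol (graphVec p₁) (graphVec p₃) = Polynomial.C c₁₃ * g)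
    (e₂₃ : Q.pol (graphVec p₂) (graphVec p₃) = Polynomial.C c₂₃ * g) :
    (linesOn f).Infinite := by
  -- On x v₁ + y v₂ + z v₃ the form takes the value g (c₁₂xy + c₁₃xz + c₂₃yz). The functions x, y, z
  -- parametrize this conic rationally, and dividing by σ = x + y + z makes the first coordinate 1
  -- again.
  let x : ℂ → ℂ := fun l => -c₂₃ * l * (1 + l)
  let y : ℂ → ℂ := fun l => -c₁₃ * (1 + l)
  let z : ℂ → ℂ := fun l => c₁₂ * l
  let σ : ℂ → ℂ := fun l => x l + y l + z l
  let w : ℂ → Fin 4 → ℂ := fun l i => (x l * p₁ i + y l * p₂ i + z l * p₃ i) / σ l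
  have hinf : {l : ℂ | σ l ≠ 0}.Infinite := by
    let P : Polynomial ℂ := Polynomial.C (-c₂₃) * Polynomial.X ^ 2
      + Polynomial.C (c₁₂ - c₁₃ - c₂₃) * Polynomial.X + Polynomial.C (-c₁₃)
    have hP : P ≠ 0 := by
      intro hP
      have := congrArg (Polynomial.eval 0) hP
      simp [P, h₁₃] at this
    have : {l : ℂ | σ l ≠ 0} = (P.roots.toFinset : Set ℂ)ᶜ := by
      ext l
      have : σ l = P.eval l := by simp [P, σ, x, y, z]; ring
      simp [hP, this]
    rw [this]
    exact (Finset.finite_toSet _).infinite_compl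
  have hvec : ∀ l, σ l ≠ 0 →
      Polynomial.C (σ l) * (graphVec (w l)).1 = Polynomial.C (x l) * (graphVec p₁).1
        + Polynomial.C (y l) * (graphVec p₂).1 + Polynomial.C (z l) * (graphVec p₃).1 ∧
      Polynomial.C (σ l) * (graphVec (w l)).2 = Polynomial.C (x l) * (graphVec p₁).2
        + Polynomial.C (y l) * (graphVec p₂).2 + Polynomial.C (z l) * (graphVec p₃).2 := by
    intro l hl
    have hw : ∀ i, Polynomial.C (σ l) * Polynomial.C (w l i) = Polynomial.C (x l) * Polynomial.C (p₁ i)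
        + Polynomial.C (y l) * Polynomial.C (p₂ i) + Polynomial.C (z l) * Polynomial.C (p₃ i) := by
      intro i
      rw [← Polynomial.C_mul, ← Polynomial.C_mul, ← Polynomial.C_mul, ← Polynomial.C_mul,
        ← Polynomial.C_add, ← Polynomial.C_add]
      congr 1
      exact mul_div_cancel₀ _ hl
    simp only [graphVec]
    constructor
    · linear_combination Polynomial.X * hw 0 + hw 1
    · linear_combination Polynomial.X * hw 2 + hw 3
  have hσC : ∀ l, Polynomial.C (σ l) = Polynomial.C (x l) + Polynomial.C (y l) + Polynomial.C (z l) :=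
    fun l => by simp [σ]
  refine Set.infinite_of_injOn_mapsTo (f := fun l => graphLine (w l)) ?_ ?_ hinf
  · intro l hl l' hl' he
    have hw : w l = w l' := graphLine_injective he
    obtain ⟨a1, a2⟩ := hvec l hl
    obtain ⟨b1, b2⟩ := hvec l' hl'
    rw [← hw] at b1 b2
    have s1 := hσC l
    have s2 := hσC l'
    have d0 : (Polynomial.C (σ l') * Polynomial.C (x l) - Polynomial.C (σ l) * Polynomial.C (x l'))
        + (Polynomial.C (σ l') * Polynomial.C (y l) - Polynomial.C (σ l) * Polynomial.C (y l'))
        + (Polynomial.C (σ l') * Polynomial.C (z l) - Polynomial.C (σ l) * Polynomial.C (z l')) = 0 := by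
      linear_combination Polynomial.C (σ l) * s2 - Polynomial.C (σ l') * s1
    have d1 := congrArg (Polynomial.C (σ l') * ·) a1
    have d1' := congrArg (Polynomial.C (σ l) * ·) b1
    have d2 := congrArg (Polynomial.C (σ l') * ·) a2
    have d2' := congrArg (Polynomial.C (σ l) * ·) b2
    -- Cramer's rule: the three vectors are independent by `hT`, so equal lines have equal
    -- barycentric coordinates, and the ratio y : z determines l.
    have hy : Polynomial.C (σ l') * Polynomial.C (y l) - Polynomial.C (σ l) * Polynomial.C (y l')
        = 0 := by
      apply mul_right_cancel₀ hT
      simp only [TernaryForm.area]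
      linear_combination ((graphVec p₃).2 - (graphVec p₁).2) * (d1' - d1 - (graphVec p₁).1 * d0)
        - ((graphVec p₃).1 - (graphVec p₁).1) * (d2' - d2 - (graphVec p₁).2 * d0)
    have hz : Polynomial.C (σ l') * Polynomial.C (z l) - Polynomial.C (σ l) * Polynomial.C (z l')
        = 0 := by
      apply mul_right_cancel₀ hT
      simp only [TernaryForm.area]
      linear_combination ((graphVec p₂).1 - (graphVec p₁).1) * (d2' - d2 - (graphVec p₁).2 * d0)
        - ((graphVec p₂).2 - (graphVec p₁).2) * (d1' - d1 - (graphVec p₁).1 * d0)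
    rw [← Polynomial.C_mul, ← Polynomial.C_mul, ← Polynomial.C_sub, Polynomial.C_eq_zero] at hy hz
    have hyz : σ l * σ l' * c₁₂ * c₁₃ * (l - l') = 0 := by
      have : σ l * σ l' * (z l * y l' - y l * z l') = 0 := by
        linear_combination σ l * y l' * hz - σ l * z l' * hy
      linear_combination -this
    have hl0 : σ l ≠ 0 := hl
    have hl0' : σ l' ≠ 0 := hl'
    simpa [hl0, hl0', h₁₂, h₁₃, sub_eq_zero] using hyz
  · intro l hl
    refine (h.graphLine_mem_linesOn_iff _).2 ?_
    obtain ⟨a1, a2⟩ := hvec l hl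
    have hS : Polynomial.C (σ l) ^ 2 ≠ 0 := pow_ne_zero 2 (by simpa using hl)
    apply mul_left_cancel₀ hS
    rw [mul_zero]
    have e : Polynomial.C (σ l) ^ 2 * Q.val 1 (graphVec (w l)).1 (graphVec (w l)).2
        = Q.val (Polynomial.C (σ l)) (Polynomial.C (σ l) * (graphVec (w l)).1)
          (Polynomial.C (σ l) * (graphVec (w l)).2) := by
      simp only [TernaryForm.val]; ring
    have e' : Polynomial.C (x l) * Polynomial.C (y l) * Polynomial.C c₁₂
        + Polynomial.C (x l) * Polynomial.C (z l) * Polynomial.C c₁₃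
        + Polynomial.C (y l) * Polynomial.C (z l) * Polynomial.C c₂₃ = 0 := by
      simp only [← Polynomial.C_mul, ← Polynomial.C_add]
      rw [Polynomial.C_eq_zero]
      simp only [x, y, z]
      ring
    rw [e, a1, a2, hσC]
    generalize Polynomial.C (x l) = x' at *
    generalize Polynomial.C (y l) = y' at *
    generalize Polynomial.C (z l) = z' at *
    simp only [TernaryForm.pol, TernaryForm.polar, TernaryForm.val] at *
    linear_combination x' ^ 2 * h₁ + y' ^ 2 * h₂ + z' ^ 2 * h₃ + x' * y' * e₁₂ + x' * z' * e₁₃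
      + y' * z' * e₂₃ + g * e'

theorem exists_not_dvd_polar (h : IsNormalForm f Q) (hfin : (linesOn f).Finite) (τ : ℂ) :
    ∃ x y z x' y' z' : Polynomial ℂ,
      ¬ (Polynomial.X - Polynomial.C τ) ∣ Q.polar x y z x' y' z' := by
  by_contra hc
  push Not at hc
  refine h.infinite_of_plane (s := τ) (t := 1) (by simp) (fun r z w => ?_) hfin
  have hroot : ∀ x y z x' y' z' : Polynomial ℂ, (Q.polar x y z x' y' z').eval τ = 0 :=
    fun x y z x' y' z' => Polynomial.dvd_iff_isRoot.1 (hc x y z x' y' z')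
  have e := hroot (Polynomial.C r) (Polynomial.C z) (Polynomial.C w) (Polynomial.C r)
    (Polynomial.C z) (Polynomial.C w)
  rw [h.specialize_one]
  simp only [TernaryForm.polar, TernaryForm.val] at e ⊢
  simp at e
  linear_combination e / 2

/-- At most 16 lines of the surface are skew to the double line. -/
theorem encard_skew_le (h : IsNormalForm f Q) (h0 : (Q.specialize 1 0).disc ≠ 0)
    (hfin : (linesOn f).Finite) : {p | graphLine p ∈ linesOn f}.encard ≤ 16 := by
  have hfin' : {p | graphLine p ∈ linesOn f}.Finite :=
    hfin.preimage graphLine_injective.injOn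
  have : Fintype {p | graphLine p ∈ linesOn f} := hfin'.fintype
  have hval : ∀ i : {p | graphLine p ∈ linesOn f}, Q.val 1 (graphVec i.1).1 (graphVec i.1).2 = 0 :=
    fun i => (h.graphLine_mem_linesOn_iff _).1 i.2
  have hself : ∀ i : {p | graphLine p ∈ linesOn f}, Q.pol (graphVec i.1) (graphVec i.1) = 0 :=
    fun i => TernaryForm.pol_self (hval i)
  have hdeg := h.natDegree_disc h0
  have hD : Q.disc ≠ 0 := by rintro hD; simp [hD] at hdeg
  have hne : ∀ i j : {p | graphLine p ∈ linesOn f}, i ≠ j →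
      Q.pol (graphVec i.1) (graphVec j.1) ≠ 0 := fun i j hij =>
    TernaryForm.pol_ne_zero hD (hval i) (hval j)
      (fun he => hij (Subtype.ext (graphVec_injective he)))
  suffices hc : Fintype.card {p | graphLine p ∈ linesOn f} ≤ 16 by
    rw [Set.encard_eq_coe_toFinset_card, Set.toFinset_card]
    exact_mod_cast hc
  have hcases := TernaryForm.card_le_or_proportional Q
    (fun i : {p | graphLine p ∈ linesOn f} => graphVec i.1) hself hne
    (fun i j => h.natDegree_pol_le (hval i) (hval j)) hdeg (h.exists_not_dvd_polar hfin)
  rcases hcases with hc | ⟨g, hg⟩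
  · exact hc
  · by_contra hlt
    obtain ⟨i, j, k, hij, hik, hjk⟩ := Fintype.two_lt_card_iff.1 (lt_of_lt_of_le (by norm_num) (not_le.1 hlt).le)
    obtain ⟨c₁₂, e₁₂⟩ := hg i j
    obtain ⟨c₁₃, e₁₃⟩ := hg i k
    obtain ⟨c₂₃, e₂₃⟩ := hg j k
    refine h.infinite_of_proportional (hval i) (hval j) (hval k) ?_ ?_ ?_ e₁₂ e₁₃ e₂₃ hfin
    · intro hT
      have := TernaryForm.gram Q _ _ _ (hself i) (hself j) (hself k)
      rw [hT] at this
      simp [hne i j hij, hne i k hik, hne j k hjk] at this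
    · rintro rfl
      exact hne i j hij (by simpa using e₁₂)
    · rintro rfl
      exact hne i k hik (by simpa using e₁₃)

/-! ### Counting secants and the total -/

/-- Each plane through the double line contains at most two further lines. -/
theorem encard_secant_le (h : IsNormalForm f Q) (hfin : (linesOn f).Finite) (τ : ℂ) :
    {L ∈ linesOn f | ∃ h₂ h₃ k₂ k₃, (k₂ ≠ 0 ∨ k₃ ≠ 0) ∧ L = secant τ 1 h₂ h₃ k₂ k₃}.encard ≤ 2 := by
  set M := {L ∈ linesOn f | ∃ h₂ h₃ k₂ k₃, (k₂ ≠ 0 ∨ k₃ ≠ 0) ∧ L = secant τ 1 h₂ h₃ k₂ k₃} with hM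
  have hMfin : M.Finite := hfin.subset fun L hL => hL.1
  rw [← hMfin.cast_ncard_eq]
  suffices hc : M.ncard ≤ 2 by exact_mod_cast hc
  by_contra hlt
  obtain ⟨L₁, m₁, L₂, m₂, L₃, m₃, h12, h13, h23⟩ := (Set.two_lt_ncard hMfin).1 (not_le.1 hlt)
  set q := Q.specialize τ 1 with hq
  -- The polar form of the residual conic, extended to ℂ⁴ by ignoring x₀; on the plane x₀ = τ x₁ the
  -- functions x₁, x₂, x₃ are coordinates. Three lines in the conic become three isotropic planes.
  let B : (Fin 4 → ℂ) →ₗ[ℂ] (Fin 4 → ℂ) →ₗ[ℂ] ℂ := LinearMap.mk₂ ℂ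
    (fun x y => q.polar (x 1) (x 2) (x 3) (y 1) (y 2) (y 3))
    (fun _ _ _ => by simp only [TernaryForm.polar, Pi.add_apply]; ring)
    (fun _ _ _ => by simp only [TernaryForm.polar, Pi.smul_apply, smul_eq_mul]; ring)
    (fun _ _ _ => by simp only [TernaryForm.polar, Pi.add_apply]; ring)
    (fun _ _ _ => by simp only [TernaryForm.polar, Pi.smul_apply, smul_eq_mul]; ring)
  have hBapp : ∀ x y, B x y = q.polar (x 1) (x 2) (x 3) (y 1) (y 2) (y 3) := fun _ _ => rfl
  let ψ : (Fin 4 → ℂ) →ₗ[ℂ] ℂ := LinearMap.proj 0 - τ • LinearMap.proj 1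
  have hψ : ∀ x, ψ x = x 0 - τ * x 1 := fun _ => rfl
  have hHdim : Module.finrank ℂ (LinearMap.ker ψ) ≤ 3 := by
    have hne : LinearMap.ker ψ ≠ ⊤ := by
      intro htop
      have : ![1, 0, 0, 0] ∈ LinearMap.ker ψ := htop ▸ Submodule.mem_top
      simp [hψ] at this
    have := Submodule.finrank_lt hne
    simp at this
    omega
  have hle : ∀ L ∈ M, L ≤ LinearMap.ker ψ := by
    rintro L ⟨-, h₂, h₃, k₂, k₃, -, rfl⟩
    rw [secant, Submodule.span_le]
    rintro x (rfl | rfl) <;> simp [hψ]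
  have hiso : ∀ L ∈ M, ∀ x ∈ L, ∀ y ∈ L, B x y = 0 := by
    rintro L ⟨hL, h₂, h₃, k₂, k₃, hk, rfl⟩ x hx y hy
    obtain ⟨e1, e2, e3⟩ := (h.secant_mem_linesOn_iff (by simp) hk).1 hL
    obtain ⟨a, b, rfl⟩ := Submodule.mem_span_pair.1 hx
    obtain ⟨a', b', rfl⟩ := Submodule.mem_span_pair.1 hy
    rw [hBapp]
    simp only [Pi.add_apply, Pi.smul_apply, smul_eq_mul, Matrix.cons_val]
    rw [← hq] at e1 e2 e3
    simp only [TernaryForm.polar, TernaryForm.val] at *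
    linear_combination 2 * a * a' * e1 + (a * b' + a' * b) * e2 + 2 * b * b' * e3
  have hzero := eq_zero_of_three_isotropic_planes B
    (fun x y => by simp only [hBapp, TernaryForm.polar]; ring) hHdim (hle _ m₁) (hle _ m₂)
    (hle _ m₃) m₁.1.1 m₂.1.1 m₃.1.1 h12 h13 h23 (hiso _ m₁) (hiso _ m₂) (hiso _ m₃)
  refine h.infinite_of_plane (s := τ) (t := 1) (by simp) (fun r z w => ?_) hfin
  have hmem : ![τ * r, r, z, w] ∈ LinearMap.ker ψ := by simp [hψ]
  have := hzero _ hmem _ hmem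
  rw [hBapp] at this
  simp only [TernaryForm.polar, TernaryForm.val, Matrix.cons_val, ← hq] at this ⊢
  linear_combination this / 2

theorem encard_linesOn_le (h : IsNormalForm f Q) (h0 : (Q.specialize 1 0).disc ≠ 0)
    (hfin : (linesOn f).Finite) : (linesOn f).encard ≤ 33 := by
  have hdeg := h.natDegree_disc h0
  have hD : Q.disc ≠ 0 := by rintro hD; simp [hD] at hdeg
  let M : ℂ → Set (Submodule ℂ (Fin 4 → ℂ)) := fun τ =>
    {L ∈ linesOn f | ∃ h₂ h₃ k₂ k₃, (k₂ ≠ 0 ∨ k₃ ≠ 0) ∧ L = secant τ 1 h₂ h₃ k₂ k₃}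
  have hsub : linesOn f ⊆ ({axis} ∪ ⋃ τ ∈ Q.disc.roots.toFinset, M τ)
      ∪ graphLine '' {p | graphLine p ∈ linesOn f} := by
    intro L hL
    rcases line_cases hL.1 with rfl | ⟨s, t, h₂, h₃, k₂, k₃, hst, hk, rfl⟩ | ⟨p, rfl⟩
    · exact Or.inl (Or.inl rfl)
    · left; right
      have hiso := (h.secant_mem_linesOn_iff hst hk).1 hL
      have hd := TernaryForm.disc_eq_zero_of_isotropic hiso.val_left hiso.polar_eq hiso.val_right hk
      -- The conic at (1 : 0) is smooth by `h0`, so every degenerate plane has a finite slope, a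
      -- root of `Q.disc`.
      have ht : t ≠ 0 := by
        rintro rfl
        have hs : s ≠ 0 := by tauto
        have e := Q.disc_specialize_mul s 1 0
        rw [mul_one, mul_zero, hd] at e
        exact (mul_ne_zero (pow_ne_zero 8 hs) h0) e.symm
      have e := Q.disc_specialize_mul t⁻¹ s t
      rw [hd, mul_zero, inv_mul_cancel₀ ht, ← h.eval_disc] at e
      simp only [Set.mem_iUnion, Multiset.mem_toFinset, exists_prop]
      refine ⟨t⁻¹ * s, (Polynomial.mem_roots hD).2 e, hL, t⁻¹ * h₂, t⁻¹ * h₃, k₂, k₃, hk, ?_⟩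
      rw [secant_smul (inv_ne_zero ht) hst hk, inv_mul_cancel₀ ht]
    · exact Or.inr ⟨p, hL, rfl⟩
  have h1 : (⋃ τ ∈ Q.disc.roots.toFinset, M τ).encard ≤ 16 := by
    refine (Finset.set_encard_biUnion_le _ _).trans ?_
    refine (Finset.sum_le_sum fun τ _ => h.encard_secant_le hfin τ).trans ?_
    have hcard : Q.disc.roots.toFinset.card ≤ 8 :=
      (Multiset.toFinset_card_le _).trans ((Polynomial.card_roots' _).trans hdeg.le)
    rw [Finset.sum_const, nsmul_eq_mul]
    have : ((Q.disc.roots.toFinset.card * 2 : ℕ) : ℕ∞) ≤ (16 : ℕ) := by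
      exact_mod_cast (by omega)
    simpa using this
  have h2 : (graphLine '' {p | graphLine p ∈ linesOn f}).encard ≤ 16 :=
    (Set.encard_image_le _ _).trans (h.encard_skew_le h0 hfin)
  calc (linesOn f).encard ≤ _ := Set.encard_le_encard hsub
    _ ≤ _ := Set.encard_union_le _ _
    _ ≤ ({axis} : Set _).encard + (⋃ τ ∈ Q.disc.roots.toFinset, M τ).encard + _ :=
        add_le_add_left (Set.encard_union_le _ _) _
    _ ≤ 1 + 16 + 16 := add_le_add (add_le_add (Set.encard_singleton _).le h1) h2
    _ = 33 := by norm_num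

end IsNormalForm

/-! ### Linear changes of coordinates and existence of the normal form -/

/-- The polynomial `f (x₀ e₀ + x₁ e₁ + x₂ e₂ + x₃ e₃)`. -/
noncomputable def linSubst (e : Fin 4 → Fin 4 → ℂ) (f : MvPolynomial (Fin 4) ℂ) :
    MvPolynomial (Fin 4) ℂ :=
  bind₁ (fun i => ∑ j, C (e j i) * X j) f

theorem eval_linSubst (e : Fin 4 → Fin 4 → ℂ) (f : MvPolynomial (Fin 4) ℂ) (x : Fin 4 → ℂ) :
    eval x (linSubst e f) = eval (∑ j, x j • e j) f := by
  rw [linSubst]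
  induction f using MvPolynomial.induction_on with
  | C a => simp
  | add p q hp hq => simp only [map_add, hp, hq]
  | mul_X p i hp => simp only [map_mul, hp, bind₁_X_right]; simp [mul_comm]

theorem eval_pderiv_linSubst (e : Fin 4 → Fin 4 → ℂ) (f : MvPolynomial (Fin 4) ℂ) (x : Fin 4 → ℂ)
    (k : Fin 4) : eval x (pderiv k (linSubst e f))
      = ∑ i, e k i * eval (∑ j, x j • e j) (pderiv i f) := by
  induction f using MvPolynomial.induction_on with
  | C a => simp [linSubst]
  | add p q hp hq =>
    simp only [linSubst, map_add] at *
    rw [hp, hq, ← Finset.sum_add_distrib]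
    exact Finset.sum_congr rfl fun i _ => by ring
  | mul_X p i hp =>
    have h1 : linSubst e (p * X i) = linSubst e p * ∑ j, C (e j i) * X j := by
      simp [linSubst]
    have h2 : pderiv k (∑ j, C (e j i) * X j : MvPolynomial (Fin 4) ℂ) = C (e k i) := by
      simp [pderiv_X, Pi.single_apply]
    have h3 : eval x (∑ j, C (e j i) * X j) = (∑ j, x j • e j) i := by simp [mul_comm]
    rw [h1, Derivation.leibniz, h2]
    simp only [smul_eq_mul, map_add, map_mul, hp, h3, Derivation.leibniz, eval_linSubst, eval_C,
      eval_X, pderiv_X]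
    simp only [mul_add, Finset.sum_add_distrib, Finset.mul_sum]
    congr 1
    · simp [Pi.single_apply, apply_ite, mul_comm]
    · exact Finset.sum_congr rfl fun i _ => by ring

theorem isHomogeneous_linSubst (e : Fin 4 → Fin 4 → ℂ) {f : MvPolynomial (Fin 4) ℂ} {d : ℕ}
    (hf : f.IsHomogeneous d) : (linSubst e f).IsHomogeneous d := by
  have := hf.aeval (fun i => ∑ j, C (e j i) * X j) (n := 1) fun i =>
    IsHomogeneous.sum _ _ _ fun j _ => by simpa using (isHomogeneous_C _ _).mul (isHomogeneous_X _ _)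
  rwa [one_mul] at this

/-- The exponent `(i, j, k, l)`. -/
noncomputable def expo (i j k l : ℕ) : Fin 4 →₀ ℕ := Finsupp.equivFunOnFinite.symm ![i, j, k, l]

theorem expo_eta (m : Fin 4 →₀ ℕ) : expo (m 0) (m 1) (m 2) (m 3) = m := by
  ext i; fin_cases i <;> rfl

theorem degree_eq_sum_fin_four (m : Fin 4 →₀ ℕ) : m.degree = m 0 + m 1 + m 2 + m 3 := by
  rw [Finsupp.degree_eq_sum, Fin.sum_univ_four]

/-- Setting x₀ = x₁ = 0 keeps exactly the monomials free of x₀ and x₁, and here the result is zero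
as a function, hence as a polynomial. -/
theorem coeff_eq_zero_of_vanishing_on_axis {h : MvPolynomial (Fin 4) ℂ}
    (hh : ∀ x : Fin 4 → ℂ, x 0 = 0 → x 1 = 0 → eval x h = 0) {m : Fin 4 →₀ ℕ} (h0 : m 0 = 0)
    (h1 : m 1 = 0) : coeff m h = 0 := by
  let κ : Fin 4 → MvPolynomial (Fin 4) ℂ := ![0, 0, X 2, X 3]
  have hκ : bind₁ κ h = 0 := by
    refine MvPolynomial.funext fun x => ?_
    have : eval x (bind₁ κ h) = eval ![0, 0, x 2, x 3] h := by
      change eval x (aeval κ h) = _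
      rw [← MvPolynomial.coe_aeval_eq_eval, ← MvPolynomial.coe_aeval_eq_eval]
      simp only [RingHom.coe_coe]
      rw [← AlgHom.comp_apply]
      congr 1
      ext i
      fin_cases i <;> simp [κ]
    rw [this, map_zero]
    exact hh _ (by simp) (by simp)
  have key : ∀ p : MvPolynomial (Fin 4) ℂ, coeff m (bind₁ κ p) = coeff m p := by
    intro p
    induction p using MvPolynomial.induction_on' with
    | add p q hp hq => simp only [map_add, coeff_add, hp, hq]
    | monomial d a =>
      have hprod : bind₁ κ (monomial d a) = C a * (κ 0 ^ d 0 * κ 1 ^ d 1 * κ 2 ^ d 2 * κ 3 ^ d 3) := by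
        rw [bind₁_monomial, ← Fin.prod_univ_four (fun i => κ i ^ d i)]
        congr 1
        exact Finset.prod_subset (Finset.subset_univ _) fun i _ hi => by
          rw [Finsupp.notMem_support_iff.1 hi, pow_zero]
      rw [hprod]
      by_cases hd : d 0 = 0 ∧ d 1 = 0
      · congr 1
        rw [monomial_eq, Finsupp.prod_fintype _ _ (fun i => pow_zero _), Fin.prod_univ_four]
        simp [κ, hd]
      · have hdm : d ≠ m := by rintro rfl; exact hd ⟨h0, h1⟩
        have hz : κ 0 ^ d 0 * κ 1 ^ d 1 = 0 := by
          rcases not_and_or.1 hd with hd | hd <;> simp [κ, hd]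
        rw [hz, coeff_monomial, if_neg hdm]
        simp
  rw [← key, hκ, coeff_zero]

/-- Dehomogenization of the binary form of degree `d` multiplying `x₂ ^ k * x₃ ^ l`. -/
noncomputable def dehom (g : MvPolynomial (Fin 4) ℂ) (d k l : ℕ) : Polynomial ℂ :=
  ∑ i ∈ Finset.range (d + 1), Polynomial.C (coeff (expo i (d - i) k l) g) * Polynomial.X ^ i

theorem natDegree_dehom_le (g : MvPolynomial (Fin 4) ℂ) (d k l : ℕ) :
    (dehom g d k l).natDegree ≤ d :=
  Polynomial.natDegree_sum_le_of_forall_le _ _ fun i hi =>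
    (Polynomial.natDegree_C_mul_X_pow_le _ _).trans (by have := Finset.mem_range.1 hi; omega)

theorem homEval_dehom (g : MvPolynomial (Fin 4) ℂ) (d k l : ℕ) (s t : ℂ) :
    homEval d (dehom g d k l) s t
      = ∑ i ∈ Finset.range (d + 1), coeff (expo i (d - i) k l) g * s ^ i * t ^ (d - i) := by
  refine Finset.sum_congr rfl fun i hi => ?_
  congr 2
  rw [dehom, Polynomial.finsetSum_coeff]
  simp only [Polynomial.coeff_C_mul, Polynomial.coeff_X_pow]
  rw [Finset.sum_eq_single i (fun j _ hj => by simp [Ne.symm hj]) (fun h => absurd hi h)]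
  simp

/-- Vanishing on the axis kills the monomials of degree 0 in (x₀, x₁), and vanishing of ∂₀g and ∂₁g
kills those of degree 1. The rest have degree at most 2 in (x₂, x₃). -/
theorem exists_isNormalForm {g : MvPolynomial (Fin 4) ℂ} (hg : g.IsHomogeneous 4)
    (h0 : ∀ x : Fin 4 → ℂ, x 0 = 0 → x 1 = 0 → eval x g = 0)
    (h1 : ∀ x : Fin 4 → ℂ, x 0 = 0 → x 1 = 0 → ∀ i, eval x (pderiv i g) = 0) :
    ∃ Q, IsNormalForm g Q := by
  have hlow : ∀ m : Fin 4 →₀ ℕ, m 0 + m 1 ≤ 1 → coeff m g = 0 := by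
    intro m hm
    have aux : ∀ i j : Fin 4, (i = 0 ∧ j = 1 ∨ i = 1 ∧ j = 0) → m i = 1 → m j = 0 →
        coeff m g = 0 := by
      intro i j hij hi hj
      have hadd : (m - fun₀ | i => 1) + (fun₀ | i => 1) = m := by
        ext k
        by_cases hk : k = i
        · subst hk; simp [hi]
        · simp [Ne.symm hk]
      have hc := coeff_eq_zero_of_vanishing_on_axis (h := pderiv i g) (m := m - fun₀ | i => 1)
        (fun x a b => h1 x a b i) (by rcases hij with ⟨rfl, rfl⟩ | ⟨rfl, rfl⟩ <;> simp [hi, hj])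
        (by rcases hij with ⟨rfl, rfl⟩ | ⟨rfl, rfl⟩ <;> simp [hi, hj])
      rw [coeff_pderiv, hadd] at hc
      simpa [hi] using hc
    rcases Nat.eq_zero_or_pos (m 0) with e0 | e0
    · rcases Nat.eq_zero_or_pos (m 1) with e1 | e1
      · exact coeff_eq_zero_of_vanishing_on_axis h0 e0 e1
      · exact aux 1 0 (by simp) (by omega) e0
    · exact aux 0 1 (by simp) (by omega) (by omega)
  refine ⟨⟨dehom g 4 0 0, dehom g 3 1 0, dehom g 3 0 1, dehom g 2 2 0, dehom g 2 1 1,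
    dehom g 2 0 2⟩, ⟨natDegree_dehom_le _ _ _ _, natDegree_dehom_le _ _ _ _,
    natDegree_dehom_le _ _ _ _, natDegree_dehom_le _ _ _ _, natDegree_dehom_le _ _ _ _,
    natDegree_dehom_le _ _ _ _, fun x => ?_⟩⟩
  classical
  let K : Finset (ℕ × ℕ) := {(0, 0), (1, 0), (0, 1), (2, 0), (1, 1), (0, 2)}
  let I : Finset ((_ : ℕ × ℕ) × ℕ) := K.sigma fun kl => Finset.range (4 - kl.1 - kl.2 + 1)
  let ex : ((_ : ℕ × ℕ) × ℕ) → (Fin 4 →₀ ℕ) := fun p =>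
    expo p.2 (4 - p.1.1 - p.1.2 - p.2) p.1.1 p.1.2
  have hinj : Function.Injective ex := by
    rintro ⟨⟨k, l⟩, i⟩ ⟨⟨k', l'⟩, i'⟩ h
    have a0 : i = i' := DFunLike.congr_fun h 0
    have a2 : k = k' := DFunLike.congr_fun h 2
    have a3 : l = l' := DFunLike.congr_fun h 3
    subst a0 a2 a3
    rfl
  have hsupp : g.support ⊆ I.image ex := by
    intro m hm
    have hc := mem_support_iff.1 hm
    have hdeg : m 0 + m 1 + m 2 + m 3 = 4 := by
      rw [← degree_eq_sum_fin_four]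
      by_contra hne
      exact hc (hg.coeff_eq_zero hne)
    have h2 : 2 ≤ m 0 + m 1 := by
      by_contra hlt
      exact hc (hlow m (by omega))
    refine Finset.mem_image.2 ⟨⟨(m 2, m 3), m 0⟩, Finset.mem_sigma.2 ⟨?_, ?_⟩, ?_⟩
    · simp only [K, Finset.mem_insert, Finset.mem_singleton, Prod.mk.injEq]
      omega
    · simp only [Finset.mem_range]
      omega
    · simp only [ex]
      rw [show 4 - m 2 - m 3 - m 0 = m 1 by omega, expo_eta]
  rw [eval_eq', Finset.sum_subset hsupp (fun m _ hm => by rw [notMem_support_iff.1 hm, zero_mul]),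
    Finset.sum_image hinj.injOn, Finset.sum_sigma]
  have hterm : ∀ i j k l : ℕ, coeff (expo i j k l) g * ∏ n, x n ^ (expo i j k l) n
      = coeff (expo i j k l) g * x 0 ^ i * x 1 ^ j * (x 2 ^ k * x 3 ^ l) := by
    intro i j k l
    rw [Fin.prod_univ_four]
    change coeff (expo i j k l) g * (x 0 ^ i * x 1 ^ j * x 2 ^ k * x 3 ^ l) = _
    ring
  have hsum : ∀ k l : ℕ, ∑ i ∈ Finset.range (4 - k - l + 1),
      coeff (ex ⟨(k, l), i⟩) g * ∏ n, x n ^ (ex ⟨(k, l), i⟩) n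
      = homEval (4 - k - l) (dehom g (4 - k - l) k l) (x 0) (x 1) * (x 2 ^ k * x 3 ^ l) := by
    intro k l
    rw [homEval_dehom, Finset.sum_mul]
    exact Finset.sum_congr rfl fun i _ => hterm _ _ _ _
  have hK : ∀ F : ℕ × ℕ → ℂ, ∑ kl ∈ K, F kl
      = F (0, 0) + F (1, 0) + F (0, 1) + F (2, 0) + F (1, 1) + F (0, 2) := by
    intro F
    simp only [K]
    rw [Finset.sum_insert (by decide), Finset.sum_insert (by decide), Finset.sum_insert (by decide),
      Finset.sum_insert (by decide), Finset.sum_insert (by decide), Finset.sum_singleton]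
    ring
  rw [hK]
  simp only [hsum]
  simp only [TernaryForm.specialize, TernaryForm.val]
  norm_num
  ring

theorem linesOn_eq_image_linSubst {e : Fin 4 → Fin 4 → ℂ}
    (he : ∀ x : Fin 4 → ℂ, ∑ j, x j • e j = 0 → x = 0) (f : MvPolynomial (Fin 4) ℂ) :
    ∃ φ : Submodule ℂ (Fin 4 → ℂ) → Submodule ℂ (Fin 4 → ℂ), Function.Injective φ ∧
      linesOn f = φ '' linesOn (linSubst e f) := by
  let Ψ : (Fin 4 → ℂ) →ₗ[ℂ] (Fin 4 → ℂ) := Fintype.linearCombination ℂ e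
  have hΨ : ∀ x, Ψ x = ∑ j, x j • e j := fun x => rfl
  have hinj : Function.Injective Ψ := (injective_iff_map_eq_zero Ψ).2 fun x hx => he x hx
  let Φ : (Fin 4 → ℂ) ≃ₗ[ℂ] (Fin 4 → ℂ) := LinearEquiv.ofInjectiveEndo Ψ hinj
  have hΦ : ∀ x, Φ x = ∑ j, x j • e j := fun x => rfl
  refine ⟨Submodule.map (Φ : (Fin 4 → ℂ) →ₗ[ℂ] (Fin 4 → ℂ)),
    Submodule.map_injective_of_injective Φ.injective, ?_⟩
  ext L
  constructor
  · rintro ⟨hL, hv⟩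
    refine ⟨L.map (Φ.symm : (Fin 4 → ℂ) →ₗ[ℂ] (Fin 4 → ℂ)), ⟨?_, ?_⟩, ?_⟩
    · exact (LinearEquiv.finrank_map_eq Φ.symm L).trans hL
    · rintro x ⟨y, hy, rfl⟩
      rw [eval_linSubst, ← hΦ]
      simpa using hv y hy
    · ext x; simp
  · rintro ⟨L, ⟨hL, hv⟩, rfl⟩
    refine ⟨(LinearEquiv.finrank_map_eq Φ L).trans hL, ?_⟩
    rintro x ⟨y, hy, rfl⟩
    have := hv y hy
    rwa [eval_linSubst, ← hΦ] at this

/-- Interpolation at six points. It allows residual conics of two normal forms to be compared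
through values of f alone. -/
theorem TernaryForm.eq_of_val_one_eq {q q' : TernaryForm ℂ}
    (h : ∀ z w, q.val 1 z w = q'.val 1 z w) : q = q' := by
  have e1 := h 0 0
  have e2 := h 1 0
  have e3 := h (-1) 0
  have e4 := h 0 1
  have e5 := h 0 (-1)
  have e6 := h 1 1
  cases q
  cases q'
  simp only [TernaryForm.val] at *
  congr 1
  · linear_combination e1
  · linear_combination (e2 - e3) / 2
  · linear_combination (e4 - e5) / 2
  · linear_combination (e2 + e3) / 2 - e1
  · linear_combination e6 - e2 - e4 + e1
  · linear_combination (e4 + e5) / 2 - e1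

theorem exists_basis_of_line {L : Submodule ℂ (Fin 4 → ℂ)} (hL : IsLine L) :
    ∃ e : Fin 4 → Fin 4 → ℂ, e 2 ∈ L ∧ e 3 ∈ L ∧
      ∀ x : Fin 4 → ℂ, ∑ j, x j • e j = 0 → x = 0 := by
  obtain ⟨M, hM⟩ := L.exists_isCompl
  have hL' : Module.finrank ℂ L = 2 := hL
  have hM' : Module.finrank ℂ M = 2 := by
    have := Submodule.finrank_add_eq_of_isCompl hM
    simp at this
    omega
  let b := Module.finBasisOfFinrankEq ℂ L hL'
  let c := Module.finBasisOfFinrankEq ℂ M hM'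
  refine ⟨![c 0, c 1, b 0, b 1], (b 0).2, (b 1).2, fun x hx => ?_⟩
  simp only [Fin.sum_univ_four, Matrix.cons_val] at hx
  have hsplit : ((x 0 • c 0 + x 1 • c 1 : M) : Fin 4 → ℂ) = -((x 2 • b 0 + x 3 • b 1 : L) : Fin 4 → ℂ) := by
    push_cast
    rw [eq_neg_iff_add_eq_zero, ← hx]
    abel
  have hM0 : (x 0 • c 0 + x 1 • c 1 : M) = 0 := by
    apply Subtype.ext
    have h1 : ((x 0 • c 0 + x 1 • c 1 : M) : Fin 4 → ℂ) ∈ L := by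
      rw [hsplit]; exact L.neg_mem (Subtype.prop _)
    exact Submodule.disjoint_def.1 hM.disjoint _ h1 (Subtype.prop _)
  have hL0 : (x 2 • b 0 + x 3 • b 1 : L) = 0 := by
    rw [hM0] at hsplit
    apply Subtype.ext
    exact neg_eq_zero.1 hsplit.symm
  have ec := Fintype.linearIndependent_iff.1 c.linearIndependent ![x 0, x 1]
    (by simpa [Fin.sum_univ_two] using hM0)
  have eb := Fintype.linearIndependent_iff.1 b.linearIndependent ![x 2, x 3]
    (by simpa [Fin.sum_univ_two] using hL0)
  have e0 := ec 0
  have e1 := ec 1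
  have e2 := eb 0
  have e3 := eb 1
  simp at e0 e1 e2 e3
  ext i; fin_cases i <;> simp [e0, e1, e2, e3]

theorem exists_isNormalForm_linSubst {f : MvPolynomial (Fin 4) ℂ} (hf : f.IsHomogeneous 4)
    {L : Submodule ℂ (Fin 4 → ℂ)} (hL : L ∈ linesOn f) (hs : ∀ v ∈ L, v ≠ 0 → IsSingularPoint f v)
    {e : Fin 4 → Fin 4 → ℂ} (h2 : e 2 ∈ L) (h3 : e 3 ∈ L) : ∃ Q, IsNormalForm (linSubst e f) Q := by
  have hmem : ∀ x : Fin 4 → ℂ, x 0 = 0 → x 1 = 0 → ∑ j, x j • e j ∈ L := by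
    intro x h0 h1
    rw [Fin.sum_univ_four, h0, h1]
    simpa using L.add_mem (L.smul_mem _ h2) (L.smul_mem _ h3)
  refine exists_isNormalForm (isHomogeneous_linSubst e hf) (fun x h0 h1 => ?_)
    (fun x h0 h1 i => ?_)
  · rw [eval_linSubst]; exact hL.2 _ (hmem x h0 h1)
  · rw [eval_pderiv_linSubst]
    refine Finset.sum_eq_zero fun k _ => ?_
    -- Singularity is assumed only at non-zero vectors; at 0 the derivatives vanish because they are
    -- cubic forms.
    by_cases hz : ∑ j, x j • e j = 0
    · have hp : (pderiv k f).IsHomogeneous 3 := hf.pderiv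
      rw [hz, eval_zero, constantCoeff_eq, hp.coeff_eq_zero (by simp), mul_zero]
    · rw [(hs _ (hmem x h0 h1) hz).2 k, mul_zero]

/-! ### The bound -/

theorem lemma3p9 (f : MvPolynomial (Fin 4) ℂ) (hf : f.IsHomogeneous 4) (hf0 : f ≠ 0)
    (hruled : ¬ RuledByLines f) (hdouble : ContainsDoubleLine f) :
    (linesOn f).encard ≤ 35 := by
  obtain ⟨L, hL, hs⟩ := hdouble
  have hfin : (linesOn f).Finite := Set.not_infinite.1 hruled
  obtain ⟨e, h2, h3, he⟩ := exists_basis_of_line hL.1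
  obtain ⟨Q, hQ⟩ := exists_isNormalForm_linSubst hf hL hs h2 h3
  obtain ⟨s, t, hst⟩ : ∃ s t, (Q.specialize s t).disc ≠ 0 := by
    by_contra hc
    push Not at hc
    obtain ⟨φ, hφ, hlines⟩ := linesOn_eq_image_linSubst he f
    rw [hlines] at hfin
    exact hQ.infinite_of_disc_eq_zero hc (hfin.of_finite_image hφ.injOn)
  obtain ⟨s', t', hdet⟩ : ∃ s' t' : ℂ, s * t' - s' * t ≠ 0 := by
    by_cases hs0 : s = 0
    · have ht : t ≠ 0 := by
        rintro rfl
        have := Q.disc_specialize_mul 0 0 0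
        simp only [mul_zero] at this
        rw [hs0, this] at hst
        simp at hst
      exact ⟨1, 0, by simpa using ht⟩
    · exact ⟨0, 1, by simpa using hs0⟩
  -- A new basis with the same last two vectors in L, in which the plane (s : t) of the smooth conic
  -- becomes (1 : 0), as `encard_linesOn_le` requires.
  let e' : Fin 4 → Fin 4 → ℂ := ![s • e 0 + t • e 1, s' • e 0 + t' • e 1, e 2, e 3]
  have hsum : ∀ x : Fin 4 → ℂ, ∑ j, x j • e' j
      = ∑ j, (![s * x 0 + s' * x 1, t * x 0 + t' * x 1, x 2, x 3] : Fin 4 → ℂ) j • e j := by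
    intro x
    simp only [Fin.sum_univ_four, e', Matrix.cons_val]
    module
  have he' : ∀ x : Fin 4 → ℂ, ∑ j, x j • e' j = 0 → x = 0 := by
    intro x hx
    rw [hsum] at hx
    have hx' := he _ hx
    have e0 := congrFun hx' 0
    have e1 := congrFun hx' 1
    have e2 := congrFun hx' 2
    have e3 := congrFun hx' 3
    simp only [Matrix.cons_val, Pi.zero_apply] at e0 e1 e2 e3
    have x0 : x 0 = 0 := by
      apply mul_left_cancel₀ hdet
      linear_combination t' * e0 - s' * e1
    have x1 : x 1 = 0 := by
      apply mul_left_cancel₀ hdet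
      linear_combination s * e1 - t * e0
    ext i; fin_cases i <;> simp [x0, x1, e2, e3]
  obtain ⟨Q', hQ'⟩ := exists_isNormalForm_linSubst hf hL hs (e := e') h2 h3
  have hspec : Q'.specialize 1 0 = Q.specialize s t := by
    refine TernaryForm.eq_of_val_one_eq fun z w => ?_
    have e1 := hQ'.eval_eq ![1, 0, z, w]
    have e2 := hQ.eval_eq ![s, t, z, w]
    rw [eval_linSubst, hsum] at e1
    rw [eval_linSubst] at e2
    simp only [Matrix.cons_val, mul_one, mul_zero, add_zero] at e1 e2
    rw [← e1, ← e2]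
  obtain ⟨φ, hφ, hlines⟩ := linesOn_eq_image_linSubst he' f
  rw [hlines] at hfin ⊢
  rw [hφ.encard_image]
  exact (hQ'.encard_linesOn_le (by rwa [hspec]) (hfin.of_finite_image hφ.injOn)).trans
    (by norm_num)
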